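/- Let $C_n\subseteq\mathbb{R}^2$ ($n\geq 1$) be the circle of radius $\frac1n$ centered at $(\frac1n,0)$, let $\mathbb{H}=\bigcup_{n\ge1}C_n\subseteq\mathbb{R}^2$ be the Hawaiian Earring, and let $\ell_n:[0,1]\to C_n$, $\ell_n(t)=\left(\frac1n(1-\cos 2\pi t),\frac1n\sin 2\pi t\right)$. For each $n\geq 1$ let $P_n=D\setminus(D_1^\circ\cup D_2^\circ)$ be a copy of a "pair of pants", where $D\subseteq\mathbb{R}^2$ is a closed disk and $D_1,D_2$ are two disjoint closed disks in the interior of $D$; for definiteness, $D$ has center $(0,0)$ and radius $4$, and $D_1,D_2$ have radius $1$ and centers $(0,2)$ and $(0,-2)$. Let $\alpha_n,\beta_n,\gamma_n:[0,1]\to P_n$ be the clockwise constant-speed parametrizations of $\partial D$, $\partial D_1$, $\partial D_2$, respectively, each starting and ending at the leftmost point of its circle. The Hawaiian Pants $\mathbb{P}$ is the adjunction space obtained from $\mathbb{H}$ by attaching all $P_n$ along their boundaries via $\alpha_n(t)\sim\ell_n(t)$, $\beta_n(t)\sim\ell_{2n}(t)$, $\gamma_n(t)\sim\ell_{2n+1}(t)$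 for all $n\geq1$ and $t\in[0,1]$, i.e., the quotient of the disjoint union $\mathbb{H}\sqcup\coprod_{n\ge1}P_n$ by these identifications, with the quotient topology. **Theorem.** $\mathbb{P}$ is 1-UV$_0$. That is, for every $x\in\mathbb{P}$ and every neighborhood $U$ of $x$ in $\mathbb{P}$ there is an open subset $V$ of $\mathbb{P}$ with $x\in V\subseteq U$ such that for every continuous map $f:D^2\to\mathbb{P}$ from the closed unit disk with $f(S^1)\subseteq V$ there is a continuous map $g:D^2\to U$ with $g|_{S^1}=f|_{S^1}$. -/

import Mathlib

/-! The Euclidean plane is written as `ℂ` throughout. -/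

/-- The clockwise parametrization of the circle with centre `c` and radius `r` that starts and ends
at the leftmost point of the circle: in coordinates,
`t ↦ (c₁ - r cos 2πt, c₂ + r sin 2πt)`. -/
noncomputable def clockwise (c : ℂ) (r : ℝ) (t : unitInterval) : ℂ :=
  c - r * Complex.exp (-(2 * Real.pi * (t : ℝ) * Complex.I))

theorem clockwise_mem_sphere (c : ℂ) {r : ℝ} (hr : 0 ≤ r) (t : unitInterval) :
    clockwise c r t ∈ Metric.sphere c r := by
  have h : ‖Complex.exp (-(2 * Real.pi * (t : ℝ) * Complex.I))‖ = 1 := by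
    have := Complex.norm_exp_ofReal_mul_I (-(2 * Real.pi * (t : ℝ)))
    simpa using this
  rw [mem_sphere_iff_norm, clockwise, sub_sub_cancel_left, norm_neg, norm_mul, h, mul_one,
    Complex.norm_real, Real.norm_of_nonneg hr]

/-- The circle `C_n` of radius `1/n` centred at `(1/n, 0)`. -/
def earringCircle (n : ℕ+) : Set ℂ :=
  Metric.sphere ((((n : ℝ)⁻¹ : ℝ)) : ℂ) ((n : ℝ)⁻¹)

/-- The Hawaiian Earring, as a subset of the plane. -/
def hawaiianEarring : Set ℂ := ⋃ n : ℕ+, earringCircle n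

/-- The loop `ℓ_n(t) = (1/n) (1 - cos 2πt, sin 2πt)` around `C_n`, based at the origin. -/
noncomputable def earringLoop (n : ℕ+) (t : unitInterval) : hawaiianEarring :=
  ⟨clockwise ((((n : ℝ)⁻¹ : ℝ)) : ℂ) ((n : ℝ)⁻¹) t,
    Set.mem_iUnion.2 ⟨n, clockwise_mem_sphere _ (by positivity) t⟩⟩

/-- A pair of pants: the closed disk of radius `4` around `0` minus the two open disks of radius
`1` around `2i` and `-2i`. -/
def pairOfPants : Set ℂ :=
  Metric.closedBall 0 4 \ (Metric.ball (2 * Complex.I) 1 ∪ Metric.ball (-(2 * Complex.I)) 1)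

theorem outer_mem (t : unitInterval) : clockwise 0 4 t ∈ pairOfPants := by
  have h := clockwise_mem_sphere 0 (r := 4) (by norm_num) t
  have h0 : ‖clockwise 0 4 t‖ = 4 := by simpa using h
  refine ⟨Metric.sphere_subset_closedBall h, ?_⟩
  have h2 : ‖2 * Complex.I‖ = 2 := by simp
  rintro (h1 | h1) <;> rw [mem_ball_iff_norm] at h1
  · have := norm_sub_norm_le (clockwise 0 4 t) (2 * Complex.I)
    linarith
  · have := norm_sub_norm_le (clockwise 0 4 t) (-(2 * Complex.I))
    rw [norm_neg] at this
    linarith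

theorem dist_centres : dist (2 * Complex.I) (-(2 * Complex.I)) = 4 := by
  rw [dist_eq_norm, show 2 * Complex.I - -(2 * Complex.I) = 4 * Complex.I by ring]
  simp

theorem leg_mem {c c' : ℂ} (hc : dist c 0 ≤ 2) (hcc : dist c c' = 4) (t : unitInterval) :
    clockwise c 1 t ∈ Metric.closedBall 0 4 \ (Metric.ball c 1 ∪ Metric.ball c' 1) := by
  have h : dist (clockwise c 1 t) c = 1 := clockwise_mem_sphere c (r := 1) (by norm_num) t
  refine ⟨?_, ?_⟩
  · have := dist_triangle (clockwise c 1 t) c 0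
    rw [Metric.mem_closedBall]
    linarith
  · rintro (h1 | h1) <;> rw [Metric.mem_ball] at h1
    · linarith
    · have := dist_triangle_left c c' (clockwise c 1 t)
      linarith

theorem legOne_mem (t : unitInterval) : clockwise (2 * Complex.I) 1 t ∈ pairOfPants :=
  leg_mem (by simp) dist_centres t

theorem legTwo_mem (t : unitInterval) : clockwise (-(2 * Complex.I)) 1 t ∈ pairOfPants := by
  rw [pairOfPants, Set.union_comm]
  exact leg_mem (by simp) (by rw [dist_comm, dist_centres]) t

/-- The clockwise boundary loop `α` of the large disk, in the pair of pants. -/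
noncomputable def outerLoop (t : unitInterval) : pairOfPants := ⟨_, outer_mem t⟩

/-- The clockwise boundary loop `β` of the first hole, in the pair of pants. -/
noncomputable def legOneLoop (t : unitInterval) : pairOfPants := ⟨_, legOne_mem t⟩

/-- The clockwise boundary loop `γ` of the second hole, in the pair of pants. -/
noncomputable def legTwoLoop (t : unitInterval) : pairOfPants := ⟨_, legTwo_mem t⟩

/-- The identifications `α_n(t) ∼ ℓ_n(t)`, `β_n(t) ∼ ℓ_{2n}(t)`, `γ_n(t) ∼ ℓ_{2n+1}(t)` on the
disjoint union of the Hawaiian Earring and of one pair of pants `P_n` for every `n ≥ 1`. -/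
inductive PantsGluing :
    hawaiianEarring ⊕ (Σ _ : ℕ+, pairOfPants) → hawaiianEarring ⊕ (Σ _ : ℕ+, pairOfPants) → Prop
  | outer (n : ℕ+) (t : unitInterval) :
      PantsGluing (Sum.inr ⟨n, outerLoop t⟩) (Sum.inl (earringLoop n t))
  | legOne (n : ℕ+) (t : unitInterval) :
      PantsGluing (Sum.inr ⟨n, legOneLoop t⟩) (Sum.inl (earringLoop (2 * n) t))
  | legTwo (n : ℕ+) (t : unitInterval) :
      PantsGluing (Sum.inr ⟨n, legTwoLoop t⟩) (Sum.inl (earringLoop (2 * n + 1) t))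

/-- The Hawaiian Pants: the quotient by the equivalence relation generated by the identifications
above, that is, the adjunction space. -/
def HawaiianPants : Type := Quot PantsGluing

/-- The Hawaiian Pants carry the quotient topology of the disjoint union topology. -/
instance : TopologicalSpace HawaiianPants := inferInstanceAs (TopologicalSpace (Quot PantsGluing))

/-- `X` is 1-UV₀ at `x`. The closed unit disk `D²` is `Metric.closedBall (0 : ℂ) 1`, and its
boundary circle consists of the points of norm `1`. -/
def IsOneUVZeroAt (X : Type*) [TopologicalSpace X] (x : X) : Prop :=
  ∀ U ∈ nhds x, ∃ V : Set X, IsOpen V ∧ x ∈ V ∧ V ⊆ U ∧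
    ∀ f : C(Metric.closedBall (0 : ℂ) 1, X),
      (∀ z : Metric.closedBall (0 : ℂ) 1, ‖(z : ℂ)‖ = 1 → f z ∈ V) →
      ∃ g : C(Metric.closedBall (0 : ℂ) 1, U),
        ∀ z : Metric.closedBall (0 : ℂ) 1, ‖(z : ℂ)‖ = 1 → (g z : X) = f z

/-- `X` is 1-UV₀ if it is 1-UV₀ at each of its points. -/
def IsOneUVZero (X : Type*) [TopologicalSpace X] : Prop :=
  ∀ x : X, IsOneUVZeroAt X x

/-! An interior point of a pair of pants has small disk neighbourhoods, so only points of the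
earring matter. There a small loop might a priori bound only large disks. Two facts exclude this. By
`exists_earring_retraction`, the whole earring can be mapped into any neighbourhood of a point with
all points close to that point fixed. By `exists_disk_in_earring`, a loop in the earring that bounds
a disk in the Hawaiian Pants also bounds one in the earring. Now a loop near a point of the earring
is pushed through the collars into the earring without leaving `U`; the pushed loop bounds a disk in
the earring, which the first fact moves into `U`; the annulus swept by the push completes the disk.

For the second fact, a compact disk meets the interiors of only finitely many pants, and these are
removed in order of decreasing index. To remove `P_k`, consider the infinite cyclic cover defined by
a circle-valued height that runs from `0` on the outer circle of `P_k` to `1` and `-1` on its legs.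
The `i`-th lift of `P_k` joins `C_k` in sheet `i` to `C_{2k}` in sheet `i + 1` and `C_{2k+1}` in
sheet `i - 1`. It therefore meets sheet `0` in at most one boundary circle, and a pair of pants can
be mapped to any one of its boundary circles with that circle fixed. These maps fit together to a
retraction `unwrap` onto sheet `0` without `P_k`: in the other sheets all circles except `C_{2k}`
and `C_{2k+1}` go to the base point, and so do the pants of index below `k`, whose boundary circles
have index below `2k`. The disk lifts to the cover, its boundary lies in a single sheet, and the
retraction removes `P_k` from it. -/

open Topology Filter

/-! ### Directions, and coordinates on the circles of the earring -/

/-- The direction of a complex number, with the convention that `0` has direction `-1`. -/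
noncomputable def dir (w : ℂ) : ℂ := if w = 0 then -1 else w / ‖w‖

theorem norm_dir (w : ℂ) : ‖dir w‖ = 1 := by
  unfold dir
  split_ifs with h
  · simp
  · simp [h]

theorem dir_of_norm_one {w : ℂ} (h : ‖w‖ = 1) : dir w = w := by
  have : w ≠ 0 := by rintro rfl; simp at h
  simp [dir, this, h]

theorem dir_dir (w : ℂ) : dir (dir w) = dir w := dir_of_norm_one (norm_dir w)

theorem dir_mul_ofReal {r : ℝ} (hr : 0 < r) {u : ℂ} (hu : ‖u‖ = 1) : dir (r * u) = u := by
  have : u ≠ 0 := by rintro rfl; simp at hu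
  have hr' : (r : ℂ) ≠ 0 := by exact_mod_cast hr.ne'
  simp [dir, this, hr', hu, abs_of_pos hr]

theorem norm_mul_dir {w : ℂ} (h : w ≠ 0) : (‖w‖ : ℂ) * dir w = w := by
  have : (‖w‖ : ℂ) ≠ 0 := by simpa using h
  simp only [dir, h, if_false]
  field_simp

theorem continuousAt_dir {w : ℂ} (h : w ≠ 0) : ContinuousAt dir w := by
  have : (fun w : ℂ => w / ‖w‖) =ᶠ[𝓝 w] dir := by
    filter_upwards [isOpen_ne.mem_nhds h] with v hv
    simp [dir, show v ≠ 0 from hv]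
  refine ContinuousAt.congr ?_ this
  refine continuousAt_id.div (by fun_prop) (by simpa using h)

theorem continuousOn_dir : ContinuousOn dir {0}ᶜ := fun _ h =>
  (continuousAt_dir h).continuousWithinAt

/-- The point of the circle `C_n` in the direction of `w`, seen from the centre. -/
noncomputable def circlePt (n : ℕ+) (w : ℂ) : hawaiianEarring :=
  ⟨((n : ℝ)⁻¹ : ℝ) + ((n : ℝ)⁻¹ : ℝ) * dir w, Set.mem_iUnion.2 ⟨n, by
    rw [earringCircle, mem_sphere_iff_norm, add_sub_cancel_left, norm_mul, norm_dir, mul_one,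
      Complex.norm_real, Real.norm_of_nonneg (by positivity)]⟩⟩

theorem circlePt_coe (n : ℕ+) (w : ℂ) :
    (circlePt n w : ℂ) = ((n : ℝ)⁻¹ : ℝ) + ((n : ℝ)⁻¹ : ℝ) * dir w := rfl

theorem circlePt_dir (n : ℕ+) (w : ℂ) : circlePt n (dir w) = circlePt n w :=
  Subtype.ext (by simp [circlePt_coe, dir_dir])

theorem mul_circlePt_sub_one (n : ℕ+) (w : ℂ) : (n : ℂ) * circlePt n w - 1 = dir w := by
  have : (n : ℂ) ≠ 0 := by exact_mod_cast n.ne_zero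
  rw [circlePt_coe]
  push_cast
  field_simp
  ring

theorem continuousOn_circlePt (n : ℕ+) : ContinuousOn (circlePt n) {0}ᶜ := by
  rw [continuousOn_iff_continuous_domRestrict]
  refine Continuous.subtype_mk ?_ _
  have := continuousOn_iff_continuous_domRestrict.1 continuousOn_dir
  exact continuous_const.add (continuous_const.mul this)

/-- The base point of the earring. -/
noncomputable def earringBase : hawaiianEarring := circlePt 1 (-1)

theorem dir_neg_one : dir (-1) = -1 := dir_of_norm_one (by simp)

theorem circlePt_neg_one (n : ℕ+) : circlePt n (-1) = earringBase :=
  Subtype.ext (by simp [earringBase, circlePt_coe, dir_neg_one])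

theorem earringBase_coe : (earringBase : ℂ) = 0 := by
  simp [earringBase, circlePt_coe, dir_neg_one]

theorem exists_eq_circlePt (h : hawaiianEarring) : ∃ n w, ‖w‖ = 1 ∧ h = circlePt n w := by
  obtain ⟨n, hn⟩ := Set.mem_iUnion.1 h.2
  rw [earringCircle, mem_sphere_iff_norm] at hn
  have h0 : (n : ℂ) ≠ 0 := by exact_mod_cast n.ne_zero
  have h1 : ‖(n : ℂ) * h - 1‖ = 1 := by
    rw [show (n : ℂ) * h - 1 = n * (h - ((n : ℝ)⁻¹ : ℝ)) by push_cast; field_simp, norm_mul, hn]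
    simp
  refine ⟨n, _, h1, Subtype.ext ?_⟩
  rw [circlePt_coe, dir_of_norm_one h1]
  push_cast
  field_simp
  ring

/-- The index of a circle of the earring through a given point. -/
noncomputable def earringIdx (h : hawaiianEarring) : ℕ+ := (exists_eq_circlePt h).choose

theorem eq_circlePt_earringIdx (h : hawaiianEarring) :
    h = circlePt (earringIdx h) ((earringIdx h : ℂ) * h - 1) := by
  obtain ⟨w, _, hw⟩ := (exists_eq_circlePt h).choose_spec
  have := mul_circlePt_sub_one (earringIdx h) w
  rw [← show h = circlePt (earringIdx h) w from hw] at this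
  rw [this, circlePt_dir]
  exact hw

theorem norm_earringIdx_mul_sub_one (h : hawaiianEarring) :
    ‖(earringIdx h : ℂ) * h - 1‖ = 1 := by
  have := mul_circlePt_sub_one (earringIdx h) ((earringIdx h : ℂ) * h - 1)
  rw [← eq_circlePt_earringIdx] at this
  rw [this, norm_dir]

/-- This is the equation of `C_n`. Off the origin it recovers `n` as a continuous function of the
point, which makes the index locally constant there. -/
theorem normSq_eq_of_norm {n : ℕ+} {h : ℂ} (hn : ‖(n : ℂ) * h - 1‖ = 1) :
    (n : ℝ) * Complex.normSq h = 2 * h.re := by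
  have h1 : Complex.normSq ((n : ℂ) * h - 1) = 1 := by
    rw [Complex.normSq_eq_norm_sq, hn]; norm_num
  have h0 : (0 : ℝ) < n := by exact_mod_cast n.pos
  rw [Complex.normSq_apply] at h1 ⊢
  simp at h1
  have : (n : ℝ) * (n * (h.re * h.re + h.im * h.im) - 2 * h.re) = 0 := by linarith
  rcases mul_eq_zero.1 this with h | h
  · exact absurd h h0.ne'
  · linarith

theorem earringIdx_eq_div {h : hawaiianEarring} (h0 : (h : ℂ) ≠ 0) :
    (earringIdx h : ℝ) = 2 * (h : ℂ).re / Complex.normSq h := by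
  rw [eq_div_iff (by simpa using h0)]
  exact normSq_eq_of_norm (norm_earringIdx_mul_sub_one h)

theorem earringIdx_circlePt {n : ℕ+} {w : ℂ} (h0 : dir w ≠ -1) : earringIdx (circlePt n w) = n := by
  have h1 : (circlePt n w : ℂ) ≠ 0 := by
    intro h
    have := mul_circlePt_sub_one n w
    rw [h] at this
    exact h0 (by rw [← this]; simp)
  have h2 := earringIdx_eq_div h1
  have h3 := normSq_eq_of_norm (n := n) (h := circlePt n w)
    (by rw [mul_circlePt_sub_one, norm_dir])
  rw [← h3, mul_div_assoc, div_self (by simpa using h1), mul_one] at h2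
  exact_mod_cast h2

theorem eventually_earringIdx_eq {h : hawaiianEarring} (h0 : (h : ℂ) ≠ 0) :
    ∀ᶠ y : hawaiianEarring in 𝓝 h, (y : ℂ) ≠ 0 ∧ earringIdx y = earringIdx h := by
  have hc : ContinuousAt (fun y : hawaiianEarring => 2 * (y : ℂ).re / Complex.normSq y) h := by
    refine ContinuousAt.div ?_ ?_ (by simpa using h0)
    · exact (continuous_const.mul (Complex.continuous_re.comp continuous_subtype_val)).continuousAt
    · exact (Complex.continuous_normSq.comp continuous_subtype_val).continuousAt
  have h1 : ∀ᶠ y : hawaiianEarring in 𝓝 h, (y : ℂ) ≠ 0 :=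
    continuous_subtype_val.continuousAt.eventually_ne h0
  filter_upwards [h1, Metric.tendsto_nhds.1 hc 1 one_pos] with y hy hd
  refine ⟨hy, ?_⟩
  rw [← earringIdx_eq_div hy, ← earringIdx_eq_div h0, Real.dist_eq] at hd
  have : |((earringIdx y : ℕ) : ℤ) - ((earringIdx h : ℕ) : ℤ)| < 1 := by exact_mod_cast hd
  rw [Int.abs_lt_one_iff] at this
  exact PNat.eq (by omega)

/-! ### Continuous maps out of the earring -/

/-- The map from the earring that is given by `φ n` on the circle `C_n`. -/
noncomputable def glueCircles {Z : Type*} (φ : ℕ+ → ℂ → Z) (h : hawaiianEarring) : Z :=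
  φ (earringIdx h) ((earringIdx h : ℂ) * h - 1)

/-- Only at the base point is the chosen index arbitrary; the common value `z₀` makes the choice
irrelevant. -/
theorem glueCircles_circlePt {Z : Type*} {φ : ℕ+ → ℂ → Z} {z₀ : Z} (hb : ∀ n, φ n (-1) = z₀)
    (n : ℕ+) (w : ℂ) : glueCircles φ (circlePt n w) = φ n (dir w) := by
  by_cases h : dir w = -1
  · have h1 : (circlePt n w : ℂ) = 0 := by simp [circlePt_coe, h]
    simp [glueCircles, h1, h, hb]
  · rw [glueCircles, earringIdx_circlePt h, mul_circlePt_sub_one]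

/-- Off the base point a single circle is visible locally. At the base point, `hl` disposes of all
but finitely many circles, and continuity of `φ n` at `-1` handles each of the rest. -/
theorem continuous_glueCircles {Z : Type*} [TopologicalSpace Z] {φ : ℕ+ → ℂ → Z} {z₀ : Z}
    (hb : ∀ n, φ n (-1) = z₀) (hc : ∀ n, ContinuousOn (φ n) (Metric.sphere 0 1))
    (hl : ∀ O ∈ 𝓝 z₀, ∀ᶠ n in cofinite, ∀ u : ℂ, ‖u‖ = 1 → φ n u ∈ O) :
    Continuous (glueCircles φ) := by
  have hcoord : ∀ n : ℕ+, Continuous (fun h : hawaiianEarring => (n : ℂ) * h - 1) := fun n => by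
    fun_prop
  rw [continuous_iff_continuousAt]
  intro h
  by_cases h0 : (h : ℂ) = 0
  · have hz : glueCircles φ h = z₀ := by simp [glueCircles, h0, hb]
    rw [ContinuousAt, hz]
    intro O hO
    have h1 : ∀ n : ℕ+, ∀ᶠ y : hawaiianEarring in 𝓝 h,
        ‖(n : ℂ) * y - 1‖ = 1 → φ n ((n : ℂ) * y - 1) ∈ O := fun n => by
      have h2 : ∀ᶠ u in 𝓝 ((n : ℂ) * h - 1), u ∈ Metric.sphere (0 : ℂ) 1 → φ n u ∈ O := by
        rw [← eventually_nhdsWithin_iff]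
        refine hc n _ (by simp [h0]) ?_
        simpa [h0, hb] using hO
      have h3 := (hcoord n).continuousAt.eventually h2
      simpa using h3
    have hfin : {n | ¬ ∀ u : ℂ, ‖u‖ = 1 → φ n u ∈ O}.Finite := hl O hO
    rw [mem_map]
    filter_upwards [(eventually_all_finite hfin).2 fun n _ => h1 n] with y hy
    rw [Set.mem_preimage]
    by_cases hbad : ∀ u : ℂ, ‖u‖ = 1 → φ (earringIdx y) u ∈ O
    · exact hbad _ (norm_earringIdx_mul_sub_one y)
    · exact hy _ hbad (norm_earringIdx_mul_sub_one y)
  · have h1 : (fun y : hawaiianEarring => φ (earringIdx h) ((earringIdx h : ℂ) * y - 1))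
        =ᶠ[𝓝 h] glueCircles φ := by
      filter_upwards [eventually_earringIdx_eq h0] with y hy
      rw [glueCircles, hy.2]
    refine ContinuousAt.congr ?_ h1
    have h2 := hc (earringIdx h) ((earringIdx h : ℂ) * h - 1)
      (by simpa using norm_earringIdx_mul_sub_one h)
    refine h2.tendsto.comp (tendsto_nhdsWithin_iff.2 ⟨(hcoord _).continuousAt, ?_⟩)
    filter_upwards [eventually_earringIdx_eq h0] with y hy
    have := norm_earringIdx_mul_sub_one y
    rw [hy.2] at this
    simpa using this

/-! ### The gluing expressed through directions, and maps out of the quotient -/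

theorem exists_clockwise_eq {c : ℂ} {r : ℝ} (hr : 0 < r) {z : ℂ} (hz : ‖z - c‖ = r) :
    ∃ t, clockwise c r t = z := by
  have hr' : (r : ℂ) ≠ 0 := by exact_mod_cast hr.ne'
  set v : ℂ := -((z - c) / r) with hv
  have hv1 : ‖v‖ = 1 := by simp [hv, hz, abs_of_pos hr, hr.ne']
  have h1 : Complex.exp (v.arg * Complex.I) = v := by
    have := Complex.norm_mul_exp_arg_mul_I v
    simpa [hv1] using this
  -- The fractional part brings the parameter into the unit interval; the discarded integer is a
  -- period of the exponential.
  refine ⟨⟨Int.fract (-v.arg / (2 * Real.pi)), Int.fract_nonneg _, (Int.fract_lt_one _).le⟩, ?_⟩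
  have h2 : Complex.exp (-(2 * Real.pi * ((Int.fract (-v.arg / (2 * Real.pi)) : ℝ) : ℂ) *
      Complex.I)) = v := by
    rw [Int.fract, ← h1, Complex.exp_eq_exp_iff_exists_int]
    refine ⟨⌊-v.arg / (2 * Real.pi)⌋, ?_⟩
    have hpi : (Real.pi : ℂ) ≠ 0 := by exact_mod_cast Real.pi_ne_zero
    rw [h1]
    push_cast
    field_simp
    ring
  rw [clockwise, h2, hv]
  field_simp
  ring

theorem dir_clockwise_sub {c : ℂ} {r : ℝ} (hr : 0 < r) (t : unitInterval) :
    dir (clockwise c r t - c) = -Complex.exp (-(2 * Real.pi * (t : ℝ) * Complex.I)) := by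
  have h : ‖-Complex.exp (-(2 * Real.pi * (t : ℝ) * Complex.I))‖ = 1 := by
    have := Complex.norm_exp_ofReal_mul_I (-(2 * Real.pi * (t : ℝ)))
    simpa using this
  rw [← dir_mul_ofReal hr h, clockwise]
  congr 1
  ring

theorem earringLoop_eq_circlePt {c : ℂ} {r : ℝ} (hr : 0 < r) (n : ℕ+) (t : unitInterval) :
    earringLoop n t = circlePt n (clockwise c r t - c) := by
  refine Subtype.ext ?_
  rw [circlePt_coe, dir_clockwise_sub hr]
  simp only [earringLoop, clockwise]
  ring

/-- The point of the Hawaiian Pants given by a point of the earring. -/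
def ofEarring (h : hawaiianEarring) : HawaiianPants := Quot.mk _ (Sum.inl h)

/-- The point of the Hawaiian Pants given by a point of the `n`-th pair of pants. -/
def ofPants (n : ℕ+) (z : pairOfPants) : HawaiianPants := Quot.mk _ (Sum.inr ⟨n, z⟩)

theorem HawaiianPants.cases (p : HawaiianPants) :
    (∃ h, p = ofEarring h) ∨ ∃ n z, p = ofPants n z := by
  induction p using Quot.ind with
  | mk a =>
    rcases a with h | ⟨n, z⟩
    · exact Or.inl ⟨h, rfl⟩
    · exact Or.inr ⟨n, z, rfl⟩

theorem ofPants_outer (n : ℕ+) {z : pairOfPants} (hz : ‖(z : ℂ)‖ = 4) :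
    ofPants n z = ofEarring (circlePt n z) := by
  obtain ⟨t, ht⟩ := exists_clockwise_eq (c := 0) (r := 4) (z := z) (by norm_num) (by simpa using hz)
  have h := Quot.sound (PantsGluing.outer n t)
  rw [earringLoop_eq_circlePt (c := 0) (r := 4) (by norm_num), sub_zero, ht] at h
  rw [show z = outerLoop t from Subtype.ext ht.symm]
  rw [show z = outerLoop t from Subtype.ext ht.symm] at h
  exact h

theorem ofPants_legOne (n : ℕ+) {z : pairOfPants} (hz : ‖(z : ℂ) - 2 * Complex.I‖ = 1) :
    ofPants n z = ofEarring (circlePt (2 * n) (z - 2 * Complex.I)) := by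
  obtain ⟨t, ht⟩ := exists_clockwise_eq one_pos hz
  have h := Quot.sound (PantsGluing.legOne n t)
  rw [earringLoop_eq_circlePt (c := 2 * Complex.I) (r := 1) (by norm_num), ht] at h
  rw [show z = legOneLoop t from Subtype.ext ht.symm]
  rw [show z = legOneLoop t from Subtype.ext ht.symm] at h
  exact h

theorem ofPants_legTwo (n : ℕ+) {z : pairOfPants} (hz : ‖(z : ℂ) + 2 * Complex.I‖ = 1) :
    ofPants n z = ofEarring (circlePt (2 * n + 1) (z + 2 * Complex.I)) := by
  rw [← sub_neg_eq_add] at hz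
  obtain ⟨t, ht⟩ := exists_clockwise_eq one_pos hz
  have h := Quot.sound (PantsGluing.legTwo n t)
  rw [earringLoop_eq_circlePt (c := -(2 * Complex.I)) (r := 1) (by norm_num), ht,
    sub_neg_eq_add] at h
  rw [show z = legTwoLoop t from Subtype.ext ht.symm]
  rw [show z = legTwoLoop t from Subtype.ext ht.symm] at h
  exact h

/-- The map on the Hawaiian Pants induced by compatible maps on the pieces. -/
def HawaiianPants.lift {Z : Type*} (a : hawaiianEarring → Z) (b : ℕ+ → pairOfPants → Z)
    (h₀ : ∀ n (z : pairOfPants), ‖(z : ℂ)‖ = 4 → b n z = a (circlePt n z))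
    (h₁ : ∀ n (z : pairOfPants), ‖(z : ℂ) - 2 * Complex.I‖ = 1 →
      b n z = a (circlePt (2 * n) (z - 2 * Complex.I)))
    (h₂ : ∀ n (z : pairOfPants), ‖(z : ℂ) + 2 * Complex.I‖ = 1 →
      b n z = a (circlePt (2 * n + 1) (z + 2 * Complex.I))) : HawaiianPants → Z :=
  Quot.lift (Sum.elim a fun x => b x.1 x.2) (by
    rintro _ _ (⟨n, t⟩ | ⟨n, t⟩ | ⟨n, t⟩)
    · have h : ‖((outerLoop t : pairOfPants) : ℂ)‖ = 4 := by
        simpa [outerLoop] using clockwise_mem_sphere 0 (r := 4) (by norm_num) t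
      have := h₀ n _ h
      rw [Sum.elim_inr, Sum.elim_inl, this,
        earringLoop_eq_circlePt (c := 0) (r := 4) (by norm_num), sub_zero]
      rfl
    · have h : ‖((legOneLoop t : pairOfPants) : ℂ) - 2 * Complex.I‖ = 1 := by
        simpa [legOneLoop] using clockwise_mem_sphere (2 * Complex.I) (r := 1) (by norm_num) t
      have := h₁ n _ h
      rw [Sum.elim_inr, Sum.elim_inl, this,
        earringLoop_eq_circlePt (c := 2 * Complex.I) (r := 1) (by norm_num)]
      rfl
    · have h : ‖((legTwoLoop t : pairOfPants) : ℂ) + 2 * Complex.I‖ = 1 := by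
        simpa [legTwoLoop] using clockwise_mem_sphere (-(2 * Complex.I)) (r := 1) (by norm_num) t
      have := h₂ n _ h
      rw [Sum.elim_inr, Sum.elim_inl, this,
        earringLoop_eq_circlePt (c := -(2 * Complex.I)) (r := 1) (by norm_num), sub_neg_eq_add]
      rfl)

theorem isOpen_hawaiianPants_iff {S : Set HawaiianPants} :
    IsOpen S ↔ IsOpen (ofEarring ⁻¹' S) ∧ ∀ n, IsOpen (ofPants n ⁻¹' S) := by
  have h : IsOpen S ↔ IsOpen (Quot.mk PantsGluing ⁻¹' S) := isQuotientMap_quot_mk.isOpen_preimage.symm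
  rw [h, isOpen_sum_iff, isOpen_sigma_iff]
  rfl

theorem continuous_ofEarring : Continuous ofEarring := continuous_quot_mk.comp continuous_inl

theorem continuous_ofPants (n : ℕ+) : Continuous (ofPants n) :=
  continuous_quot_mk.comp (continuous_inr.comp continuous_sigmaMk)

/-- A quotient map restricts to a quotient map over a locally closed set. Concretely, a relatively
open subset of `O ∩ C` becomes open in the whole space once `Cᶜ` is added, and this can be tested on
the pieces. -/
theorem HawaiianPants.continuousOn_of_pieces {Z : Type*} [TopologicalSpace Z]
    {F : HawaiianPants → Z} {O C : Set HawaiianPants} (hO : IsOpen O) (hC : IsClosed C)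
    (hE : ContinuousOn (fun h => F (ofEarring h)) (ofEarring ⁻¹' (O ∩ C)))
    (hP : ∀ n, ContinuousOn (fun z => F (ofPants n z)) (ofPants n ⁻¹' (O ∩ C))) :
    ContinuousOn F (O ∩ C) := by
  rw [continuousOn_iff']
  intro t ht
  rw [continuousOn_iff'] at hE
  obtain ⟨u, hu, hu'⟩ := hE t ht
  have : ∀ n, ∃ u, IsOpen u ∧ (fun z => F (ofPants n z)) ⁻¹' t ∩ ofPants n ⁻¹' (O ∩ C) =
      u ∩ ofPants n ⁻¹' (O ∩ C) := fun n => continuousOn_iff'.1 (hP n) t ht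
  choose v hv hv' using this
  have key : ∀ {Y : Type} (q : Y → HawaiianPants) (w : Set Y),
      (fun y => F (q y)) ⁻¹' t ∩ q ⁻¹' (O ∩ C) = w ∩ q ⁻¹' (O ∩ C) →
      q ⁻¹' ((F ⁻¹' t ∩ O) ∪ Cᶜ) = (w ∩ q ⁻¹' O) ∪ q ⁻¹' Cᶜ := fun q w hw => by
    ext y
    have := Set.ext_iff.1 hw y
    simp only [Set.mem_inter_iff, Set.mem_preimage, Set.mem_union, Set.mem_compl_iff] at this ⊢
    tauto
  refine ⟨(F ⁻¹' t ∩ O) ∪ Cᶜ, ?_, ?_⟩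
  · refine isOpen_hawaiianPants_iff.2 ⟨?_, fun n => ?_⟩
    · rw [key _ _ hu']
      exact (hu.inter (hO.preimage continuous_ofEarring)).union
        (hC.isOpen_compl.preimage continuous_ofEarring)
    · rw [key _ _ (hv' n)]
      exact ((hv n).inter (hO.preimage (continuous_ofPants n))).union
        (hC.isOpen_compl.preimage (continuous_ofPants n))
  · ext y
    simp only [Set.mem_inter_iff, Set.mem_preimage, Set.mem_union, Set.mem_compl_iff]
    tauto

theorem HawaiianPants.continuous_of_pieces {Z : Type*} [TopologicalSpace Z]
    {F : HawaiianPants → Z} (hE : Continuous (fun h => F (ofEarring h)))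
    (hP : ∀ n, Continuous (fun z => F (ofPants n z))) : Continuous F := by
  rw [← continuousOn_univ, ← Set.inter_univ Set.univ]
  exact continuousOn_of_pieces isOpen_univ isClosed_univ hE.continuousOn
    fun n => (hP n).continuousOn

/-! ### Interior points of the pants -/

theorem norm_le_of_mem_pants (z : pairOfPants) : ‖(z : ℂ)‖ ≤ 4 := by
  simpa using z.2.1

theorem one_le_norm_sub (z : pairOfPants) : 1 ≤ ‖(z : ℂ) - 2 * Complex.I‖ := by
  by_contra h
  exact z.2.2 (Or.inl (by rw [mem_ball_iff_norm]; exact not_le.1 h))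

theorem one_le_norm_add (z : pairOfPants) : 1 ≤ ‖(z : ℂ) + 2 * Complex.I‖ := by
  by_contra h
  exact z.2.2 (Or.inr (by rw [mem_ball_iff_norm, sub_neg_eq_add]; exact not_le.1 h))

theorem mem_pairOfPants {z : ℂ} (h₀ : ‖z‖ ≤ 4) (h₁ : 1 ≤ ‖z - 2 * Complex.I‖)
    (h₂ : 1 ≤ ‖z + 2 * Complex.I‖) : z ∈ pairOfPants := by
  refine ⟨by simpa using h₀, ?_⟩
  rintro (h | h) <;> rw [mem_ball_iff_norm] at h
  · linarith
  · rw [sub_neg_eq_add] at h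
    linarith

theorem four_le_norm_sub_add (z : ℂ) : 4 ≤ ‖z - 2 * Complex.I‖ + ‖z + 2 * Complex.I‖ := by
  have := norm_sub_le (z + 2 * Complex.I) (z - 2 * Complex.I)
  rw [show z + 2 * Complex.I - (z - 2 * Complex.I) = 4 * Complex.I by ring] at this
  simp at this
  linarith

theorem norm_le_norm_sub_two_I_add (z : ℂ) : ‖z‖ ≤ ‖z - 2 * Complex.I‖ + 2 := by
  have := norm_add_le (z - 2 * Complex.I) (2 * Complex.I)
  simpa using this

theorem norm_le_norm_add_two_I_add (z : ℂ) : ‖z‖ ≤ ‖z + 2 * Complex.I‖ + 2 := by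
  have := norm_sub_le (z + 2 * Complex.I) (2 * Complex.I)
  simpa using this

/-- The interior points of a pair of pants. -/
def pantsInterior : Set ℂ :=
  {z | ‖z‖ < 4 ∧ 1 < ‖z - 2 * Complex.I‖ ∧ 1 < ‖z + 2 * Complex.I‖}

theorem isOpen_pantsInterior : IsOpen pantsInterior := by
  have h₀ : IsOpen {z : ℂ | ‖z‖ < 4} := isOpen_lt (by fun_prop) (by fun_prop)
  have h₁ : IsOpen {z : ℂ | 1 < ‖z - 2 * Complex.I‖} := isOpen_lt (by fun_prop) (by fun_prop)
  have h₂ : IsOpen {z : ℂ | 1 < ‖z + 2 * Complex.I‖} := isOpen_lt (by fun_prop) (by fun_prop)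
  exact h₀.inter (h₁.inter h₂)

theorem pantsInterior_subset : pantsInterior ⊆ pairOfPants := fun _ hz =>
  mem_pairOfPants hz.1.le hz.2.1.le hz.2.2.le

theorem mem_pantsInterior_or (z : pairOfPants) : (z : ℂ) ∈ pantsInterior ∨ ‖(z : ℂ)‖ = 4 ∨
    ‖(z : ℂ) - 2 * Complex.I‖ = 1 ∨ ‖(z : ℂ) + 2 * Complex.I‖ = 1 := by
  by_contra h
  push Not at h
  exact h.1 ⟨lt_of_le_of_ne (norm_le_of_mem_pants z) h.2.1,
    lt_of_le_of_ne (one_le_norm_sub z) h.2.2.1.symm,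
    lt_of_le_of_ne (one_le_norm_add z) h.2.2.2.symm⟩

open Classical in
/-- The coordinate of a point of the Hawaiian Pants that is interior to a pair of pants. -/
noncomputable def pantsCoord : HawaiianPants → Option (ℕ+ × ℂ) :=
  HawaiianPants.lift (fun _ => none)
    (fun n z => if (z : ℂ) ∈ pantsInterior then some (n, (z : ℂ)) else none)
    (fun _ _ hz => if_neg fun h => h.1.ne hz) (fun _ _ hz => if_neg fun h => h.2.1.ne' hz)
    (fun _ _ hz => if_neg fun h => h.2.2.ne' hz)

theorem pantsCoord_ofEarring (h : hawaiianEarring) : pantsCoord (ofEarring h) = none := rfl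

theorem pantsCoord_ofPants_of_mem {n : ℕ+} {z : pairOfPants} (hz : (z : ℂ) ∈ pantsInterior) :
    pantsCoord (ofPants n z) = some (n, (z : ℂ)) := if_pos hz

theorem pantsCoord_ofPants_of_notMem {n : ℕ+} {z : pairOfPants} (hz : (z : ℂ) ∉ pantsInterior) :
    pantsCoord (ofPants n z) = none := if_neg hz

/-- The points that are interior to the `n`-th pair of pants. -/
def openPants (n : ℕ+) : Set HawaiianPants := {p | ∃ z, pantsCoord p = some (n, z)}

theorem ofEarring_notMem_openPants (n : ℕ+) (h : hawaiianEarring) :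
    ofEarring h ∉ openPants n := by
  rintro ⟨z, hz⟩
  simp [pantsCoord_ofEarring] at hz

/-- Since `pantsCoord` is defined on the quotient, the gluing identifies an interior point neither
with a point of other pants nor with a point of the earring. -/
theorem ofPants_mem_openPants {m n : ℕ+} {z : pairOfPants} :
    ofPants m z ∈ openPants n ↔ m = n ∧ (z : ℂ) ∈ pantsInterior := by
  by_cases hz : (z : ℂ) ∈ pantsInterior
  · constructor
    · rintro ⟨w, hw⟩
      rw [pantsCoord_ofPants_of_mem hz] at hw
      simp only [Option.some.injEq, Prod.mk.injEq] at hw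
      exact ⟨hw.1, hz⟩
    · rintro ⟨rfl, _⟩
      exact ⟨_, pantsCoord_ofPants_of_mem hz⟩
  · constructor
    · rintro ⟨w, hw⟩
      rw [pantsCoord_ofPants_of_notMem hz] at hw
      simp at hw
    · exact fun h => absurd h.2 hz

theorem isOpen_openPants (n : ℕ+) : IsOpen (openPants n) := by
  refine isOpen_hawaiianPants_iff.2 ⟨?_, fun m => ?_⟩
  · convert isOpen_empty
    ext h
    simpa using ofEarring_notMem_openPants n h
  · by_cases hm : m = n
    · convert isOpen_pantsInterior.preimage continuous_subtype_val using 1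
      ext z
      simp [ofPants_mem_openPants, hm]
    · convert isOpen_empty
      ext z
      simp [ofPants_mem_openPants, hm]

theorem exists_eq_ofEarring {n : ℕ+} {z : pairOfPants} (hz : (z : ℂ) ∉ pantsInterior) :
    ∃ h, ofPants n z = ofEarring h := by
  rcases mem_pantsInterior_or z with h | h | h | h
  · exact absurd h hz
  · exact ⟨_, ofPants_outer n h⟩
  · exact ⟨_, ofPants_legOne n h⟩
  · exact ⟨_, ofPants_legTwo n h⟩

theorem exists_eq_ofEarring_or (p : HawaiianPants) :
    (∃ h, p = ofEarring h) ∨ ∃ n z, p = ofPants n z ∧ (z : ℂ) ∈ pantsInterior := by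
  rcases p.cases with ⟨h, rfl⟩ | ⟨n, z, rfl⟩
  · exact Or.inl ⟨h, rfl⟩
  · by_cases hz : (z : ℂ) ∈ pantsInterior
    · exact Or.inr ⟨n, z, rfl, hz⟩
    · exact Or.inl (exists_eq_ofEarring hz)

/-- The plane coordinate of an interior point of a pair of pants. -/
noncomputable def planeCoord (p : HawaiianPants) : ℂ := ((pantsCoord p).getD (1, 0)).2

theorem planeCoord_ofPants {n : ℕ+} {z : pairOfPants} (hz : (z : ℂ) ∈ pantsInterior) :
    planeCoord (ofPants n z) = z := by
  simp [planeCoord, pantsCoord_ofPants_of_mem hz]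

theorem continuousOn_planeCoord (n : ℕ+) : ContinuousOn planeCoord (openPants n) := by
  rw [← Set.inter_univ (openPants n)]
  refine HawaiianPants.continuousOn_of_pieces (isOpen_openPants n) isClosed_univ ?_ fun m => ?_
  · intro h hh
    exact absurd hh.1 (ofEarring_notMem_openPants n h)
  · refine continuous_subtype_val.continuousOn.congr fun z hz => ?_
    exact planeCoord_ofPants (ofPants_mem_openPants.1 hz.1).2

theorem mem_openPants_iff {n : ℕ+} {p : HawaiianPants} :
    p ∈ openPants n ↔ ∃ z : pairOfPants, p = ofPants n z ∧ (z : ℂ) ∈ pantsInterior := by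
  constructor
  · intro hp
    rcases exists_eq_ofEarring_or p with ⟨h, rfl⟩ | ⟨m, z, rfl, hz⟩
    · exact absurd hp (ofEarring_notMem_openPants n h)
    · rw [ofPants_mem_openPants] at hp
      exact ⟨z, by rw [hp.1], hz⟩
  · rintro ⟨z, rfl, hz⟩
    exact ofPants_mem_openPants.2 ⟨rfl, hz⟩

/-! ### Compact sets meet finitely many open pants -/

/-- The union of the earring and of the pairs of pants with index at most `k`. -/
def pantsUpTo (k : ℕ) : Set HawaiianPants := {p | ∀ n : ℕ+, k < n → p ∉ openPants n}

theorem isClosed_pantsUpTo (k : ℕ) : IsClosed (pantsUpTo k) := by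
  have : pantsUpTo k = ⋂ n : ℕ+, ⋂ _ : k < n, (openPants n)ᶜ := by
    ext p
    simp [pantsUpTo]
  rw [this]
  exact isClosed_iInter fun n => isClosed_iInter fun _ => (isOpen_openPants n).isClosed_compl

theorem ofEarring_mem_pantsUpTo (k : ℕ) (h : hawaiianEarring) : ofEarring h ∈ pantsUpTo k :=
  fun n _ => ofEarring_notMem_openPants n h

/-- Otherwise the set contains interior points of pants of unbounded index. Any set of such points
is closed, because it has finitely many points in each piece; so the complements of the tails form
an increasing open cover without a finite subcover. -/
theorem exists_subset_pantsUpTo {K : Set HawaiianPants} (hK : IsCompact K) :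
    ∃ k, K ⊆ pantsUpTo k := by
  classical
  by_contra! hcon
  have h1 : ∀ k : ℕ, ∃ p ∈ K, ∃ n : ℕ+, k < n ∧ p ∈ openPants n := fun k => by
    obtain ⟨p, hp, hp'⟩ := Set.not_subset.1 (hcon k)
    simp only [pantsUpTo, Set.mem_ofPred_eq, not_forall, not_not] at hp'
    obtain ⟨n, hn, hn'⟩ := hp'
    exact ⟨p, hp, n, hn, hn'⟩
  choose p hpK n hn hp using h1
  choose z hz hz' using fun k => mem_openPants_iff.1 (hp k)
  let A : ℕ → Set HawaiianPants := fun j => {x | ∀ k, j ≤ k → x ≠ ofPants (n k) (z k)}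
  have hpre : ∀ (m : ℕ+) (w : pairOfPants) (k : ℕ), ofPants m w = ofPants (n k) (z k) →
      m = n k ∧ w = z k := fun m w k h => by
    have h2 : ofPants m w ∈ openPants (n k) := by
      rw [h]; exact ofPants_mem_openPants.2 ⟨rfl, hz' k⟩
    have h3 := (ofPants_mem_openPants.1 h2)
    have h4 := planeCoord_ofPants (n := m) h3.2
    rw [h, planeCoord_ofPants (hz' k)] at h4
    exact ⟨h3.1, Subtype.ext h4.symm⟩
  have hAo : ∀ j, IsOpen (A j) := fun j => by
    refine isOpen_hawaiianPants_iff.2 ⟨?_, fun m => ?_⟩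
    · convert isOpen_univ
      ext h
      simp only [A, Set.mem_preimage, Set.mem_ofPred_eq, Set.mem_univ, iff_true]
      intro k _ hk
      exact ofEarring_notMem_openPants (n k) h
        (by rw [hk]; exact ofPants_mem_openPants.2 ⟨rfl, hz' k⟩)
    -- The `k`-th point lies in pants of index greater than `k`, so only those with `k < m` can lie
    -- in the `m`-th pants.
    · have hfin : (z '' {k | k < m}).Finite := (Set.finite_lt_nat m).image z
      have hfin2 : (ofPants m ⁻¹' (A j)ᶜ).Finite := by
        refine hfin.subset fun w hw => ?_
        simp only [A, Set.mem_preimage, Set.mem_compl_iff, Set.mem_ofPred_eq, not_forall,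
          not_not] at hw
        obtain ⟨k, _, hk⟩ := hw
        obtain ⟨hm, hw⟩ := hpre m w k hk
        exact ⟨k, by rw [Set.mem_ofPred_eq, hm]; exact hn k, hw.symm⟩
      have := hfin2.isClosed.isOpen_compl
      simpa using this
  obtain ⟨j, hj⟩ := hK.elim_directed_cover A hAo (fun x _ => by
      by_contra hx
      simp only [Set.mem_iUnion, not_exists] at hx
      simp only [A, Set.mem_ofPred_eq, not_forall, not_not] at hx
      obtain ⟨k, _, hk⟩ := hx 0
      -- A point in every tail also equals a chosen point with number `l ≥ n k`; its pants then have
      -- index `n l > l ≥ n k`, yet `n l = n k`.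
      obtain ⟨l, hl, hl'⟩ := hx (n k)
      have := (hpre _ _ _ (hk.symm.trans hl')).1
      have h2 := hn l
      rw [← this] at h2
      omega)
    (directed_of_isDirected_le fun i j hij x hx k hk => hx k (hij.trans hk))
  exact hj (hpK j) j le_rfl (hz j)

/-! ### Pushing the collars into the boundary circles -/

/-- The projection of the plane to the closed unit disk. -/
noncomputable def unitClamp (w : ℂ) : ℂ := w / (max ‖w‖ 1 : ℝ)

theorem continuous_unitClamp : Continuous unitClamp := by
  refine continuous_id.div (by fun_prop) fun w => ?_
  have : (0 : ℝ) < max ‖w‖ 1 := lt_max_of_lt_right one_pos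
  exact_mod_cast this.ne'

/-- On the pants, `unitClamp` can replace `dir` for the two legs; unlike `dir` it is continuous at
`0`, so `collarPush` is continuous on the whole plane. -/
theorem unitClamp_of_one_le {w : ℂ} (h : 1 ≤ ‖w‖) : unitClamp w = dir w := by
  have : w ≠ 0 := by rintro rfl; norm_num at h
  simp [unitClamp, dir, this, h]

theorem add_mul_unitClamp {w : ℂ} (h : 1 ≤ ‖w‖) (s : ℝ) :
    w + s * unitClamp w = ((‖w‖ + s : ℝ) : ℂ) * dir w := by
  have : w ≠ 0 := by rintro rfl; norm_num at h
  rw [unitClamp_of_one_le h]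
  nth_rewrite 1 [← norm_mul_dir this]
  push_cast
  ring

/-- The displacement that pushes a collar of the circle of radius `1` inwards. -/
noncomputable def innerPush (r : ℝ) : ℝ := min (r - 1) (max 0 (3 / 2 - r))

/-- The displacement that pushes a collar of the circle of radius `4` outwards. -/
noncomputable def outerPush (r : ℝ) : ℝ := min (4 - r) (max 0 (r - 7 / 2))

theorem innerPush_nonneg {r : ℝ} (h : 1 ≤ r) : 0 ≤ innerPush r :=
  le_min (by linarith) (le_max_left _ _)

theorem innerPush_le (r : ℝ) : innerPush r ≤ r - 1 := min_le_left _ _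

theorem innerPush_of_ge {r : ℝ} (h : 3 / 2 ≤ r) : innerPush r = 0 := by
  rw [innerPush, max_eq_left (by linarith), min_eq_right (by linarith)]

theorem innerPush_of_le {r : ℝ} (h : r ≤ 5 / 4) : innerPush r = r - 1 :=
  min_eq_left (le_max_of_le_right (by linarith))

theorem outerPush_nonneg {r : ℝ} (h : r ≤ 4) : 0 ≤ outerPush r :=
  le_min (by linarith) (le_max_left _ _)

theorem outerPush_le (r : ℝ) : outerPush r ≤ 4 - r := min_le_left _ _

theorem outerPush_of_le {r : ℝ} (h : r ≤ 7 / 2) : outerPush r = 0 := by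
  rw [outerPush, max_eq_left (by linarith), min_eq_right (by linarith)]

theorem outerPush_of_ge {r : ℝ} (h : 15 / 4 ≤ r) : outerPush r = 4 - r :=
  min_eq_left (le_max_of_le_right (by linarith))

/-- The homotopy that pushes the collars of the boundary circles into these circles. -/
noncomputable def collarPush (t : ℝ) (z : ℂ) : ℂ :=
  z + ((-(t * innerPush ‖z - 2 * Complex.I‖) : ℝ) : ℂ) * unitClamp (z - 2 * Complex.I) +
    ((-(t * innerPush ‖z + 2 * Complex.I‖) : ℝ) : ℂ) * unitClamp (z + 2 * Complex.I) +
    ((t * outerPush ‖z‖ : ℝ) : ℂ) * unitClamp z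

theorem continuous_collarPush : Continuous (fun x : ℝ × ℂ => collarPush x.1 x.2) := by
  have h1 : Continuous innerPush := by unfold innerPush; fun_prop
  have h2 : Continuous outerPush := by unfold outerPush; fun_prop
  have h3 := continuous_unitClamp
  unfold collarPush
  fun_prop

theorem collarPush_zero (z : ℂ) : collarPush 0 z = z := by simp [collarPush]

/-- The three displacements have disjoint supports: within `3 / 2` of `2i`, the distance to `-2i` is
at least `5 / 2` and the norm at most `7 / 2`, so the other two vanish and the motion is radial. -/
theorem collarPush_of_legOne {z : ℂ} (h : 1 ≤ ‖z - 2 * Complex.I‖)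
    (h' : ‖z - 2 * Complex.I‖ ≤ 3 / 2) (t : ℝ) : collarPush t z - 2 * Complex.I =
      ((‖z - 2 * Complex.I‖ - t * innerPush ‖z - 2 * Complex.I‖ : ℝ) : ℂ) *
        dir (z - 2 * Complex.I) := by
  rw [collarPush, innerPush_of_ge (r := ‖z + 2 * Complex.I‖) (by linarith [four_le_norm_sub_add z]),
    outerPush_of_le (by linarith [norm_le_norm_sub_two_I_add z]), sub_eq_add_neg (‖_‖ : ℝ),
    ← add_mul_unitClamp h]
  simp
  ring

theorem collarPush_of_legTwo {z : ℂ} (h : 1 ≤ ‖z + 2 * Complex.I‖)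
    (h' : ‖z + 2 * Complex.I‖ ≤ 3 / 2) (t : ℝ) : collarPush t z + 2 * Complex.I =
      ((‖z + 2 * Complex.I‖ - t * innerPush ‖z + 2 * Complex.I‖ : ℝ) : ℂ) *
        dir (z + 2 * Complex.I) := by
  rw [collarPush, innerPush_of_ge (r := ‖z - 2 * Complex.I‖) (by linarith [four_le_norm_sub_add z]),
    outerPush_of_le (by linarith [norm_le_norm_add_two_I_add z]), sub_eq_add_neg (‖_‖ : ℝ),
    ← add_mul_unitClamp h]
  simp
  ring

theorem collarPush_of_outer {z : ℂ} (h : 7 / 2 ≤ ‖z‖) (t : ℝ) : collarPush t z =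
      ((‖z‖ + t * outerPush ‖z‖ : ℝ) : ℂ) * dir z := by
  rw [collarPush, innerPush_of_ge (r := ‖z - 2 * Complex.I‖)
      (by linarith [norm_le_norm_sub_two_I_add z]),
    innerPush_of_ge (by linarith [norm_le_norm_add_two_I_add z]),
    ← add_mul_unitClamp (by linarith)]
  simp

/-- At most one displacement acts at a given point, and it moves the point radially no further than
the boundary circle. -/
theorem collarPush_mem {t : ℝ} (ht : t ∈ Set.Icc (0 : ℝ) 1) (z : pairOfPants) :
    collarPush t z ∈ pairOfPants := by
  have h1 := one_le_norm_sub z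
  have h2 := one_le_norm_add z
  have h0 := norm_le_of_mem_pants z
  by_cases h1' : ‖(z : ℂ) - 2 * Complex.I‖ ≤ 3 / 2
  · have hb := innerPush_nonneg h1
    have hb' := innerPush_le ‖(z : ℂ) - 2 * Complex.I‖
    have hn := congrArg norm (collarPush_of_legOne h1 h1' t)
    rw [norm_mul, norm_dir, mul_one, Complex.norm_real, Real.norm_of_nonneg
      (by nlinarith [ht.1, ht.2])] at hn
    have := norm_le_norm_sub_two_I_add (collarPush t z)
    have := four_le_norm_sub_add (collarPush t z)
    have := mul_nonneg ht.1 hb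
    have := mul_le_of_le_one_left hb ht.2
    exact mem_pairOfPants (by linarith) (by linarith) (by linarith)
  by_cases h2' : ‖(z : ℂ) + 2 * Complex.I‖ ≤ 3 / 2
  · have hb := innerPush_nonneg h2
    have hb' := innerPush_le ‖(z : ℂ) + 2 * Complex.I‖
    have hn := congrArg norm (collarPush_of_legTwo h2 h2' t)
    rw [norm_mul, norm_dir, mul_one, Complex.norm_real, Real.norm_of_nonneg
      (by nlinarith [ht.1, ht.2])] at hn
    have := norm_le_norm_add_two_I_add (collarPush t z)
    have := four_le_norm_sub_add (collarPush t z)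
    have := mul_nonneg ht.1 hb
    have := mul_le_of_le_one_left hb ht.2
    exact mem_pairOfPants (by linarith) (by linarith) (by linarith)
  by_cases h0' : 7 / 2 ≤ ‖(z : ℂ)‖
  · have hb := outerPush_nonneg h0
    have hb' := outerPush_le ‖(z : ℂ)‖
    have := mul_nonneg ht.1 hb
    have := mul_le_of_le_one_left hb ht.2
    have hn := congrArg norm (collarPush_of_outer h0' t)
    rw [norm_mul, norm_dir, mul_one, Complex.norm_real, Real.norm_of_nonneg (by linarith)] at hn
    have := norm_le_norm_sub_two_I_add (collarPush t z)
    have := norm_le_norm_add_two_I_add (collarPush t z)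
    exact mem_pairOfPants (by linarith) (by linarith) (by linarith)
  · push Not at h1' h2' h0'
    have : collarPush t z = z := by
      simp [collarPush, innerPush_of_ge h1'.le, innerPush_of_ge h2'.le, outerPush_of_le h0'.le]
    rw [this]
    exact z.2

theorem collarPush_of_norm_eq {z : ℂ} (hz : ‖z‖ = 4) (t : ℝ) : collarPush t z = z := by
  have h0 : z ≠ 0 := by rintro rfl; norm_num at hz
  rw [collarPush_of_outer (by linarith), outerPush_of_ge (by linarith), hz]
  have := norm_mul_dir h0
  rw [hz] at this
  simpa using this

theorem collarPush_of_norm_sub_eq {z : ℂ} (hz : ‖z - 2 * Complex.I‖ = 1) (t : ℝ) :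
    collarPush t z = z := by
  have h := collarPush_of_legOne hz.ge (by linarith) t
  rw [innerPush_of_le (by linarith), hz, dir_of_norm_one hz] at h
  simpa using h

theorem collarPush_of_norm_add_eq {z : ℂ} (hz : ‖z + 2 * Complex.I‖ = 1) (t : ℝ) :
    collarPush t z = z := by
  have h := collarPush_of_legTwo hz.ge (by linarith) t
  rw [innerPush_of_le (by linarith), hz, dir_of_norm_one hz] at h
  simpa using h

/-- The track of a point of a pair of pants under the collar push. -/
noncomputable def pantsTrack (z : pairOfPants) : C(unitInterval, pairOfPants) where
  toFun t := ⟨collarPush t z, collarPush_mem t.2 z⟩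
  continuous_toFun := by
    refine Continuous.subtype_mk ?_ _
    exact continuous_collarPush.comp (continuous_subtype_val.prodMk continuous_const)

theorem continuous_pantsTrack : Continuous pantsTrack := by
  refine ContinuousMap.continuous_of_continuous_uncurry _ ?_
  refine Continuous.subtype_mk ?_ _
  exact continuous_collarPush.comp ((continuous_subtype_val.comp continuous_snd).prodMk
    (continuous_subtype_val.comp continuous_fst))

theorem pantsTrack_eq_const {z : pairOfPants} (h : ∀ t : ℝ, collarPush t z = z) :
    pantsTrack z = ContinuousMap.const _ z :=
  ContinuousMap.ext fun t => Subtype.ext (h t)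

/-- The track of a point of the Hawaiian Pants under the collar push. -/
noncomputable def track : HawaiianPants → C(unitInterval, HawaiianPants) :=
  HawaiianPants.lift (fun h => ContinuousMap.const _ (ofEarring h))
    (fun n z => (ContinuousMap.mk _ (continuous_ofPants n)).comp (pantsTrack z))
    (fun n z hz => by
      rw [pantsTrack_eq_const (collarPush_of_norm_eq hz), ← ofPants_outer n hz]; rfl)
    (fun n z hz => by
      rw [pantsTrack_eq_const (collarPush_of_norm_sub_eq hz), ← ofPants_legOne n hz]; rfl)
    (fun n z hz => by
      rw [pantsTrack_eq_const (collarPush_of_norm_add_eq hz), ← ofPants_legTwo n hz]; rfl)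

theorem track_ofPants (n : ℕ+) (z : pairOfPants) (t : unitInterval) :
    track (ofPants n z) t = ofPants n (pantsTrack z t) := rfl

/-- With values in the path space, the homotopy is a map out of the quotient alone, so continuity is
checked on the pieces and no product of the quotient with an interval is needed. -/
theorem continuous_track : Continuous track := by
  refine HawaiianPants.continuous_of_pieces ?_ fun n => ?_
  · exact ContinuousMap.continuous_of_continuous_uncurry _ (continuous_ofEarring.comp continuous_fst)
  · exact (ContinuousMap.continuous_postcomp
      (ContinuousMap.mk _ (continuous_ofPants n))).comp continuous_pantsTrack

theorem track_zero (p : HawaiianPants) : track p 0 = p := by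
  rcases p.cases with ⟨h, rfl⟩ | ⟨n, z, rfl⟩
  · rfl
  · rw [track_ofPants]
    congr 1
    exact Subtype.ext (collarPush_zero z)

/-! ### Projection of the collars to the earring -/

open Classical in
/-- The radial projection of the collars of a pair of pants to the earring. -/
noncomputable def pantsToEarring (n : ℕ+) (z : ℂ) : hawaiianEarring :=
  if ‖z - 2 * Complex.I‖ < 5 / 4 then circlePt (2 * n) (z - 2 * Complex.I)
  else if ‖z + 2 * Complex.I‖ < 5 / 4 then circlePt (2 * n + 1) (z + 2 * Complex.I)
  else circlePt n z

theorem pantsToEarring_legOne (n : ℕ+) {z : ℂ} (h : ‖z - 2 * Complex.I‖ < 5 / 4) :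
    pantsToEarring n z = circlePt (2 * n) (z - 2 * Complex.I) := if_pos h

theorem pantsToEarring_legTwo (n : ℕ+) {z : ℂ} (h : ‖z + 2 * Complex.I‖ < 5 / 4) :
    pantsToEarring n z = circlePt (2 * n + 1) (z + 2 * Complex.I) := by
  rw [pantsToEarring, if_neg (by linarith [four_le_norm_sub_add z]), if_pos h]

theorem pantsToEarring_outer (n : ℕ+) {z : ℂ} (h : 15 / 4 < ‖z‖) :
    pantsToEarring n z = circlePt n z := by
  rw [pantsToEarring, if_neg (by linarith [norm_le_norm_sub_two_I_add z]),
    if_neg (by linarith [norm_le_norm_add_two_I_add z])]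

/-- The projection of the collars to the earring, extended by arbitrary values elsewhere. -/
noncomputable def toEarring : HawaiianPants → hawaiianEarring :=
  HawaiianPants.lift id (fun n z => pantsToEarring n z)
    (fun n z hz => pantsToEarring_outer n (by rw [hz]; norm_num))
    (fun n z hz => pantsToEarring_legOne n (by rw [hz]; norm_num))
    (fun n z hz => pantsToEarring_legTwo n (by rw [hz]; norm_num))

theorem toEarring_ofEarring (h : hawaiianEarring) : toEarring (ofEarring h) = h := rfl

theorem toEarring_ofPants (n : ℕ+) (z : pairOfPants) :
    toEarring (ofPants n z) = pantsToEarring n z := rfl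

/-- The collars of the boundary circles of a pair of pants. -/
def pantsCollar : Set ℂ :=
  {z | ‖z - 2 * Complex.I‖ < 5 / 4 ∨ ‖z + 2 * Complex.I‖ < 5 / 4 ∨ 15 / 4 < ‖z‖}

theorem isOpen_pantsCollar : IsOpen pantsCollar := by
  have h₀ : IsOpen {z : ℂ | 15 / 4 < ‖z‖} := isOpen_lt (by fun_prop) (by fun_prop)
  have h₁ : IsOpen {z : ℂ | ‖z - 2 * Complex.I‖ < 5 / 4} := isOpen_lt (by fun_prop) (by fun_prop)
  have h₂ : IsOpen {z : ℂ | ‖z + 2 * Complex.I‖ < 5 / 4} := isOpen_lt (by fun_prop) (by fun_prop)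
  exact h₁.union (h₂.union h₀)

/-- The union of the earring and of all collars. -/
def collar : Set HawaiianPants :=
  {p | HawaiianPants.lift (fun _ => True) (fun _ z => (z : ℂ) ∈ pantsCollar)
    (fun _ _ hz => eq_true (Or.inr (Or.inr (by rw [hz]; norm_num))))
    (fun _ _ hz => eq_true (Or.inl (by rw [hz]; norm_num)))
    (fun _ _ hz => eq_true (Or.inr (Or.inl (by rw [hz]; norm_num)))) p}

theorem ofEarring_mem_collar (h : hawaiianEarring) : ofEarring h ∈ collar := trivial

theorem ofPants_mem_collar {n : ℕ+} {z : pairOfPants} :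
    ofPants n z ∈ collar ↔ (z : ℂ) ∈ pantsCollar := Iff.rfl

theorem isOpen_collar : IsOpen collar :=
  isOpen_hawaiianPants_iff.2 ⟨isOpen_univ, fun _ =>
    isOpen_pantsCollar.preimage continuous_subtype_val⟩

theorem continuousOn_pantsToEarring (n : ℕ+) :
    ContinuousOn (pantsToEarring n) (pantsCollar ∩ pairOfPants) := by
  rintro z ⟨hz, hp⟩
  refine ContinuousAt.continuousWithinAt ?_
  have hcont : ∀ (m : ℕ+) (c : ℂ), z + c ≠ 0 → ContinuousAt (fun w => circlePt m (w + c)) z :=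
    fun m c h => ContinuousAt.comp (f := fun w => w + c)
      ((continuousOn_circlePt m).continuousAt (isOpen_compl_singleton.mem_nhds h)) (by fun_prop)
  have h1 := one_le_norm_sub ⟨z, hp⟩
  have h2 := one_le_norm_add ⟨z, hp⟩
  rcases hz with h | h | h
  · refine ContinuousAt.congr (hcont (2 * n) (-(2 * Complex.I)) ?_) ?_
    · rw [← sub_eq_add_neg, ← norm_pos_iff]; exact one_pos.trans_le h1
    · have : {w : ℂ | ‖w - 2 * Complex.I‖ < 5 / 4} ∈ 𝓝 z :=
        (isOpen_lt (by fun_prop) (by fun_prop)).mem_nhds h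
      filter_upwards [this] with w hw
      rw [pantsToEarring_legOne n hw, sub_eq_add_neg]
  · refine ContinuousAt.congr (hcont (2 * n + 1) (2 * Complex.I) ?_) ?_
    · rw [← norm_pos_iff]; exact one_pos.trans_le h2
    · have : {w : ℂ | ‖w + 2 * Complex.I‖ < 5 / 4} ∈ 𝓝 z :=
        (isOpen_lt (by fun_prop) (by fun_prop)).mem_nhds h
      filter_upwards [this] with w hw
      rw [pantsToEarring_legTwo n hw]
  · refine ContinuousAt.congr (hcont n 0 ?_) ?_
    · rw [add_zero, ← norm_pos_iff]; linarith
    · have : {w : ℂ | 15 / 4 < ‖w‖} ∈ 𝓝 z :=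
        (isOpen_lt (by fun_prop) (by fun_prop)).mem_nhds h
      filter_upwards [this] with w hw
      rw [pantsToEarring_outer n hw, add_zero]

theorem continuousOn_toEarring : ContinuousOn toEarring collar := by
  rw [← Set.inter_univ collar]
  refine HawaiianPants.continuousOn_of_pieces isOpen_collar isClosed_univ
    continuous_id.continuousOn fun n => ?_
  exact (continuousOn_pantsToEarring n).comp continuous_subtype_val.continuousOn
    fun z hz => ⟨hz.1, z.2⟩

/-- Within the collars the displacement at time `1` is exactly the distance to the boundary circle,
so the push ends on that circle in the same direction. -/
theorem track_one {p : HawaiianPants} (hp : p ∈ collar) : track p 1 = ofEarring (toEarring p) := by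
  rcases p.cases with ⟨h, rfl⟩ | ⟨n, z, rfl⟩
  · rfl
  rw [track_ofPants, toEarring_ofPants]
  have hval : (pantsTrack z 1 : ℂ) = collarPush 1 z := rfl
  rcases ofPants_mem_collar.1 hp with h | h | h
  · have h1 := collarPush_of_legOne (one_le_norm_sub z) (by linarith) 1
    rw [innerPush_of_le h.le, ← hval] at h1
    have h2 : (pantsTrack z 1 : ℂ) - 2 * Complex.I = dir (z - 2 * Complex.I) := by simpa using h1
    rw [ofPants_legOne n (by rw [h2, norm_dir]), pantsToEarring_legOne n h, h2, circlePt_dir]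
  · have h1 := collarPush_of_legTwo (one_le_norm_add z) (by linarith) 1
    rw [innerPush_of_le h.le, ← hval] at h1
    have h2 : (pantsTrack z 1 : ℂ) + 2 * Complex.I = dir (z + 2 * Complex.I) := by simpa using h1
    rw [ofPants_legTwo n (by rw [h2, norm_dir]), pantsToEarring_legTwo n h, h2, circlePt_dir]
  · have h1 := collarPush_of_outer (z := z) (by linarith) 1
    rw [outerPush_of_ge h.le, ← hval] at h1
    have h2 : (pantsTrack z 1 : ℂ) = ((4 : ℝ) : ℂ) * dir z := by
      rw [h1]; congr 2; ring
    rw [ofPants_outer n (by rw [h2, norm_mul, norm_dir]; simp), pantsToEarring_outer n h, h2]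
    rw [← circlePt_dir, dir_mul_ofReal (by norm_num) (norm_dir _), circlePt_dir]

/-! ### Maps from a pair of pants to each of its boundary circles -/

/-- A bump function around the first hole, with value `1` on the boundary of the hole. -/
noncomputable def legOneBump (z : ℂ) : ℝ := max 0 (3 - 2 * ‖z - 2 * Complex.I‖)

/-- A bump function around the second hole, with value `1` on the boundary of the hole. -/
noncomputable def legTwoBump (z : ℂ) : ℝ := max 0 (3 - 2 * ‖z + 2 * Complex.I‖)

theorem continuous_legOneBump : Continuous legOneBump := by unfold legOneBump; fun_prop

theorem continuous_legTwoBump : Continuous legTwoBump := by unfold legTwoBump; fun_prop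

theorem legOneBump_of_ge {z : ℂ} (h : 3 / 2 ≤ ‖z - 2 * Complex.I‖) : legOneBump z = 0 :=
  max_eq_left (by linarith)

theorem legTwoBump_of_ge {z : ℂ} (h : 3 / 2 ≤ ‖z + 2 * Complex.I‖) : legTwoBump z = 0 :=
  max_eq_left (by linarith)

theorem legOneBump_of_eq {z : ℂ} (h : ‖z - 2 * Complex.I‖ = 1) : legOneBump z = 1 := by
  rw [legOneBump, h]; norm_num

theorem legTwoBump_of_eq {z : ℂ} (h : ‖z + 2 * Complex.I‖ = 1) : legTwoBump z = 1 := by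
  rw [legTwoBump, h]; norm_num

theorem legOneBump_of_norm_eq {z : ℂ} (h : ‖z‖ = 4) : legOneBump z = 0 :=
  legOneBump_of_ge (by linarith [norm_le_norm_sub_two_I_add z])

theorem legTwoBump_of_norm_eq {z : ℂ} (h : ‖z‖ = 4) : legTwoBump z = 0 :=
  legTwoBump_of_ge (by linarith [norm_le_norm_add_two_I_add z])

theorem legOneBump_of_legTwo {z : ℂ} (h : ‖z + 2 * Complex.I‖ ≤ 3 / 2) : legOneBump z = 0 :=
  legOneBump_of_ge (by linarith [four_le_norm_sub_add z])

theorem legTwoBump_of_legOne {z : ℂ} (h : ‖z - 2 * Complex.I‖ ≤ 3 / 2) : legTwoBump z = 0 :=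
  legTwoBump_of_ge (by linarith [four_le_norm_sub_add z])

theorem norm_star_sub (z : ℂ) : ‖star z - 2 * Complex.I‖ = ‖z + 2 * Complex.I‖ := by
  rw [← norm_star (z + _)]
  congr 1
  simp [sub_eq_add_neg]

/-- A nowhere vanishing function on the pair of pants that is the identity on the outer circle,
constant on the second leg, and of degree one on the first leg. -/
noncomputable def outerMap (z : ℂ) : ℂ :=
  ((1 - legTwoBump z : ℝ) : ℂ) * (z - (2 * min 1 (4 - ‖z‖) : ℝ) * Complex.I) - (legTwoBump z : ℝ)

theorem continuous_outerMap : Continuous outerMap := by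
  have := continuous_legTwoBump
  unfold outerMap
  fun_prop

theorem outerMap_outer {z : ℂ} (h : ‖z‖ = 4) : outerMap z = z := by
  simp [outerMap, legTwoBump_of_norm_eq h, h]

theorem outerMap_legTwo {z : ℂ} (h : ‖z + 2 * Complex.I‖ = 1) : outerMap z = -1 := by
  simp [outerMap, legTwoBump_of_eq h]

theorem norm_neg_one_add_le : ‖(-1 : ℂ) + 2 * Complex.I‖ ≤ 3 := by
  have := norm_add_le (-1 : ℂ) (2 * Complex.I)
  simp at this
  linarith

/-- The marked point of each leg has to go in direction `-1`; then the maps induced on the circles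
of neighbouring sheets agree at the base point of the earring. -/
theorem outerMap_legOne_base : outerMap (-1 + 2 * Complex.I) = -1 := by
  rw [outerMap, legTwoBump_of_legOne (by norm_num),
    min_eq_left (by linarith [norm_neg_one_add_le])]
  simp

/-- Near the second leg `z - 2ci` has negative imaginary part, so mixing it with `-1` creates no
zero. Elsewhere a zero means `z = 2ci`; then `‖z‖ = 2c ≤ 2` forces `c = 1`, and `2i` lies in the
first hole. -/
theorem outerMap_ne_zero (z : pairOfPants) : outerMap z ≠ 0 := by
  have h1 := one_le_norm_sub z
  have h2 := one_le_norm_add z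
  have h0 := norm_le_of_mem_pants z
  set c : ℝ := min 1 (4 - ‖(z : ℂ)‖) with hc
  have hc0 : 0 ≤ c := le_min (by norm_num) (by linarith)
  have hc1 : c ≤ 1 := min_le_left _ _
  intro h
  rw [outerMap] at h
  have him := congrArg Complex.im h
  have hre := congrArg Complex.re h
  simp only [Complex.sub_re, Complex.sub_im, Complex.re_ofReal_mul, Complex.im_ofReal_mul,
    Complex.ofReal_re, Complex.ofReal_im, Complex.zero_re, Complex.zero_im, Complex.I_re,
    Complex.I_im, mul_zero, mul_one, sub_zero] at him hre
  rw [← hc] at him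
  rcases mul_eq_zero.1 him with hm | hm
  · rw [hm, zero_mul] at hre
    linarith
  · have him' : (z : ℂ).im = 2 * c := by linarith
    have hμ : legTwoBump z = 0 := by
      refine legTwoBump_of_ge ?_
      have := Complex.abs_im_le_norm ((z : ℂ) + 2 * Complex.I)
      simp only [Complex.add_im, Complex.mul_im, Complex.I_im, Complex.I_re, him'] at this
      norm_num at this
      linarith [le_abs_self (2 * c + 2)]
    rw [hμ] at hre
    have hre' : (z : ℂ).re = 0 := by linarith
    have hz : (z : ℂ) = ((2 * c : ℝ) : ℂ) * Complex.I := by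
      apply Complex.ext <;> simp [hre', him']
    have hn : ‖(z : ℂ)‖ = 2 * c := by
      rw [hz, norm_mul, Complex.norm_I, mul_one, Complex.norm_real,
        Real.norm_of_nonneg (by linarith)]
    have hc' : c = 1 := by
      rw [hc]
      exact min_eq_left (by linarith)
    rw [hz, hc'] at h1
    norm_num at h1

/-- A nowhere vanishing function on the pair of pants that is constant on the outer circle, a
translation on the first leg, and of degree minus one on the second leg. -/
noncomputable def legOneMap (z : ℂ) : ℂ :=
  ((1 - max 0 (2 * ‖z‖ - 7) : ℝ) : ℂ) *
    ((((1 - legTwoBump z : ℝ) : ℂ) * (z - 2 * Complex.I) - (legTwoBump z : ℝ)) *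
      ((legOneBump z : ℝ) - ((1 - legOneBump z : ℝ) : ℂ) * star (z + 2 * Complex.I))) -
    ((max 0 (2 * ‖z‖ - 7) : ℝ) : ℂ)

theorem continuous_legOneMap : Continuous legOneMap := by
  have h1 := continuous_legOneBump
  have h2 := continuous_legTwoBump
  unfold legOneMap
  fun_prop

theorem legOneMap_outer {z : ℂ} (h : ‖z‖ = 4) : legOneMap z = -1 := by
  rw [legOneMap, h]
  norm_num

theorem legOneMap_legOne {z : ℂ} (h : ‖z - 2 * Complex.I‖ = 1) :
    legOneMap z = z - 2 * Complex.I := by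
  rw [legOneMap, legOneBump_of_eq h, legTwoBump_of_legOne (by linarith),
    max_eq_left (by linarith [norm_le_norm_sub_two_I_add z])]
  simp

theorem legOneMap_legTwo_base : legOneMap (-1 - 2 * Complex.I) = -1 := by
  have h : ‖(-1 - 2 * Complex.I : ℂ) + 2 * Complex.I‖ = 1 := by norm_num
  rw [legOneMap, legTwoBump_of_eq h, legOneBump_of_legTwo (by linarith),
    max_eq_left (by linarith [norm_le_norm_add_two_I_add (-1 - 2 * Complex.I)])]
  simp

/-- The factors `z - 2i` and `star (z + 2i)` wind oppositely around the outer circle, which allows a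
constant value there. Each factor is mixed with a real constant only where it is not real, namely
near the opposite leg. -/
theorem legOneMap_ne_zero (z : pairOfPants) : legOneMap z ≠ 0 := by
  have h1 := one_le_norm_sub z
  have h2 := one_le_norm_add z
  have h0 := norm_le_of_mem_pants z
  have hw1 : (z : ℂ) - 2 * Complex.I ≠ 0 := norm_pos_iff.1 (by linarith)
  have hw2 : star ((z : ℂ) + 2 * Complex.I) ≠ 0 := by
    rw [← norm_pos_iff, norm_star]; linarith
  by_cases h0' : ‖(z : ℂ)‖ ≤ 7 / 2
  · rw [legOneMap, max_eq_left (by linarith)]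
    simp only [sub_zero, Complex.ofReal_one, one_mul, Complex.ofReal_zero]
    refine mul_ne_zero ?_ ?_
    · intro h
      have him := congrArg Complex.im h
      have hre := congrArg Complex.re h
      simp only [Complex.sub_re, Complex.sub_im, Complex.re_ofReal_mul, Complex.im_ofReal_mul,
        Complex.ofReal_re, Complex.ofReal_im, Complex.zero_re, Complex.zero_im, sub_zero] at him hre
      rcases mul_eq_zero.1 him with hm | hm
      · rw [hm] at hre
        linarith
      · simp at hm
        have hμ : legTwoBump z = 0 := by
          refine legTwoBump_of_ge ?_
          have := Complex.abs_im_le_norm ((z : ℂ) + 2 * Complex.I)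
          simp at this
          rw [show (z : ℂ).im = 2 by linarith] at this
          norm_num at this
          linarith
        rw [hμ] at h
        simp at h
        exact hw1 h
    · intro h
      have him := congrArg Complex.im h
      have hre := congrArg Complex.re h
      simp only [Complex.sub_re, Complex.sub_im, Complex.re_ofReal_mul, Complex.im_ofReal_mul,
        Complex.ofReal_re, Complex.ofReal_im, Complex.zero_re, Complex.zero_im, zero_sub,
        neg_eq_zero] at him hre
      rcases mul_eq_zero.1 him with hm | hm
      · rw [hm] at hre
        linarith
      · simp at hm
        have hν : legOneBump z = 0 := by
          refine legOneBump_of_ge ?_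
          have := Complex.abs_im_le_norm ((z : ℂ) - 2 * Complex.I)
          simp at this
          rw [show (z : ℂ).im = -2 by linarith] at this
          norm_num at this
          linarith
        rw [hν] at h
        simp only [Complex.ofReal_zero, sub_zero, Complex.ofReal_one, one_mul, zero_sub,
          neg_eq_zero] at h
        exact hw2 h
  -- Here both leg bumps vanish, and the product has real part `4 - ‖z‖²`, which is negative; hence
  -- mixing it with `-1` creates no zero.
  · push Not at h0'
    set κ : ℝ := max 0 (2 * ‖(z : ℂ)‖ - 7) with hκ
    have hκ0 : 0 < κ := lt_max_of_lt_right (by linarith)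
    have hκ1 : κ ≤ 1 := max_le (by norm_num) (by linarith)
    intro h
    rw [legOneMap, legOneBump_of_ge (by linarith [norm_le_norm_sub_two_I_add (z : ℂ)]),
      legTwoBump_of_ge (by linarith [norm_le_norm_add_two_I_add (z : ℂ)]), ← hκ] at h
    have hre := congrArg Complex.re h
    have hsq : (z : ℂ).re ^ 2 + (z : ℂ).im ^ 2 = ‖(z : ℂ)‖ ^ 2 := by
      rw [← Complex.normSq_eq_norm_sq, Complex.normSq_apply]; ring
    rw [Complex.sub_re, Complex.re_ofReal_mul] at hre
    simp at hre
    nlinarith [mul_nonneg (sub_nonneg.2 hκ1) (sq_nonneg (‖(z : ℂ)‖ - 7 / 2))]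

/-- The mirror image of `legOneMap`. -/
noncomputable def legTwoMap (z : ℂ) : ℂ := star (legOneMap (star z))

theorem norm_star_add (z : ℂ) : ‖star z + 2 * Complex.I‖ = ‖z - 2 * Complex.I‖ := by
  rw [← norm_star_sub, star_star]

theorem star_mem_pairOfPants {z : ℂ} (hz : z ∈ pairOfPants) : star z ∈ pairOfPants :=
  mem_pairOfPants (by rw [norm_star]; exact norm_le_of_mem_pants ⟨z, hz⟩)
    (by rw [norm_star_sub]; exact one_le_norm_add ⟨z, hz⟩)
    (by rw [norm_star_add]; exact one_le_norm_sub ⟨z, hz⟩)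

theorem continuous_legTwoMap : Continuous legTwoMap :=
  continuous_star.comp (continuous_legOneMap.comp continuous_star)

theorem legTwoMap_outer {z : ℂ} (h : ‖z‖ = 4) : legTwoMap z = -1 := by
  rw [legTwoMap, legOneMap_outer (by rwa [norm_star])]
  simp

theorem legTwoMap_legTwo {z : ℂ} (h : ‖z + 2 * Complex.I‖ = 1) :
    legTwoMap z = z + 2 * Complex.I := by
  rw [legTwoMap, legOneMap_legOne (by rwa [norm_star_sub])]
  simp

theorem legTwoMap_legOne_base : legTwoMap (-1 + 2 * Complex.I) = -1 := by
  rw [legTwoMap, show star (-1 + 2 * Complex.I) = -1 - 2 * Complex.I by simp; ring,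
    legOneMap_legTwo_base]
  simp

theorem legTwoMap_ne_zero (z : pairOfPants) : legTwoMap z ≠ 0 := by
  rw [legTwoMap, star_ne_zero]
  exact legOneMap_ne_zero ⟨_, star_mem_pairOfPants z.2⟩

/-! ### The sheets of the infinite cyclic cover -/

/-- The base point of the Hawaiian Pants. -/
noncomputable def pantsBase : HawaiianPants := ofEarring earringBase

/-- For every sheet `i` of an infinite cyclic cover, a map from the `k`-th pair of pants in this
sheet to the earring. -/
noncomputable def sheetMap (k : ℕ+) (i : ℤ) (z : ℂ) : HawaiianPants :=
  if i = 0 then ofEarring (circlePt k (outerMap z))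
  else if i = -1 then ofEarring (circlePt (2 * k) (legOneMap z))
  else if i = 1 then ofEarring (circlePt (2 * k + 1) (legTwoMap z))
  else pantsBase

theorem sheetMap_mem_range (k : ℕ+) (i : ℤ) (z : ℂ) : sheetMap k i z ∈ Set.range ofEarring := by
  unfold sheetMap
  split_ifs <;> exact ⟨_, rfl⟩

theorem continuousOn_ofEarring_circlePt (n : ℕ+) {f : ℂ → ℂ} (hf : Continuous f)
    (h0 : ∀ z : pairOfPants, f z ≠ 0) :
    ContinuousOn (fun z => ofEarring (circlePt n (f z))) pairOfPants :=
  continuous_ofEarring.comp_continuousOn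
    ((continuousOn_circlePt n).comp hf.continuousOn fun z hz => h0 ⟨z, hz⟩)

theorem continuousOn_sheetMap (k : ℕ+) (i : ℤ) : ContinuousOn (sheetMap k i) pairOfPants := by
  unfold sheetMap
  split_ifs
  · exact continuousOn_ofEarring_circlePt _ continuous_outerMap outerMap_ne_zero
  · exact continuousOn_ofEarring_circlePt _ continuous_legOneMap legOneMap_ne_zero
  · exact continuousOn_ofEarring_circlePt _ continuous_legTwoMap legTwoMap_ne_zero
  · exact continuousOn_const

theorem sheetMap_zero_outer (k : ℕ+) {z : ℂ} (h : ‖z‖ = 4) :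
    sheetMap k 0 z = ofEarring (circlePt k z) := by
  simp [sheetMap, outerMap_outer h]

theorem sheetMap_outer (k : ℕ+) {i : ℤ} (hi : i ≠ 0) {z : ℂ} (h : ‖z‖ = 4) :
    sheetMap k i z = pantsBase := by
  simp [sheetMap, legOneMap_outer h, legTwoMap_outer h, hi, circlePt_neg_one, pantsBase]

theorem sheetMap_legOne (k : ℕ+) {z : ℂ} (h : ‖z - 2 * Complex.I‖ = 1) :
    sheetMap k (-1) z = ofEarring (circlePt (2 * k) (z - 2 * Complex.I)) := by
  simp [sheetMap, legOneMap_legOne h]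

theorem sheetMap_legTwo (k : ℕ+) {z : ℂ} (h : ‖z + 2 * Complex.I‖ = 1) :
    sheetMap k 1 z = ofEarring (circlePt (2 * k + 1) (z + 2 * Complex.I)) := by
  simp [sheetMap, legTwoMap_legTwo h]

theorem sheetMap_legOne_base (k : ℕ+) (i : ℤ) :
    sheetMap k i (-1 + 2 * Complex.I) = pantsBase := by
  have h : legOneMap (-1 + 2 * Complex.I) = -1 := by
    rw [legOneMap_legOne] <;> simp
  unfold sheetMap
  split_ifs <;>
    simp [outerMap_legOne_base, h, legTwoMap_legOne_base, circlePt_neg_one, pantsBase]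

theorem sheetMap_legTwo_base (k : ℕ+) (i : ℤ) :
    sheetMap k i (-1 - 2 * Complex.I) = pantsBase := by
  have h : legTwoMap (-1 - 2 * Complex.I) = -1 := by
    rw [legTwoMap_legTwo] <;> simp
  have h' : outerMap (-1 - 2 * Complex.I) = -1 := by
    rw [outerMap_legTwo]; simp
  unfold sheetMap
  split_ifs <;> simp [h', h, legOneMap_legTwo_base, circlePt_neg_one, pantsBase]

/-- The maps on the circles of the earring in sheet `j` of the cover. -/
noncomputable def sheetCircle (k : ℕ+) (j : ℤ) (n : ℕ+) (u : ℂ) : HawaiianPants :=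
  if n = 2 * k then sheetMap k (j - 1) (u + 2 * Complex.I)
  else if n = 2 * k + 1 then sheetMap k (j + 1) (u - 2 * Complex.I)
  else pantsBase

theorem two_mul_add_one_ne (k : ℕ+) : 2 * k + 1 ≠ 2 * k := fun h => by
  have := congrArg PNat.val h
  simp at this

theorem self_ne_two_mul (k : ℕ+) : k ≠ 2 * k := fun h => by
  have := congrArg PNat.val h
  have := k.pos
  simp at *

theorem self_ne_two_mul_add_one (k : ℕ+) : k ≠ 2 * k + 1 := fun h => by
  have := congrArg PNat.val h
  have := k.pos
  simp at *
  omega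

theorem sheetCircle_neg_one (k : ℕ+) (j : ℤ) (n : ℕ+) : sheetCircle k j n (-1) = pantsBase := by
  unfold sheetCircle
  split_ifs
  · exact sheetMap_legOne_base k _
  · exact sheetMap_legTwo_base k _
  · rfl

open Classical in
/-- The map on the earring in sheet `j` of the cover. -/
noncomputable def sheetEarring (k : ℕ+) (j : ℤ) : hawaiianEarring → HawaiianPants :=
  if j = 0 then ofEarring else glueCircles (sheetCircle k j)

theorem sheetEarring_zero (k : ℕ+) : sheetEarring k 0 = ofEarring := if_pos rfl

theorem sheetEarring_circlePt (k : ℕ+) {j : ℤ} (hj : j ≠ 0) (n : ℕ+) (w : ℂ) :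
    sheetEarring k j (circlePt n w) = sheetCircle k j n (dir w) := by
  rw [sheetEarring, if_neg hj, glueCircles_circlePt (sheetCircle_neg_one k j)]

theorem mem_pairOfPants_legOne {u : ℂ} (hu : ‖u‖ = 1) : u + 2 * Complex.I ∈ pairOfPants := by
  have h1 : ‖u + 2 * Complex.I - 2 * Complex.I‖ = 1 := by simpa using hu
  exact mem_pairOfPants (by linarith [norm_le_norm_sub_two_I_add (u + 2 * Complex.I)]) h1.ge
    (by linarith [four_le_norm_sub_add (u + 2 * Complex.I)])

theorem mem_pairOfPants_legTwo {u : ℂ} (hu : ‖u‖ = 1) : u - 2 * Complex.I ∈ pairOfPants := by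
  have h1 : ‖u - 2 * Complex.I + 2 * Complex.I‖ = 1 := by simpa using hu
  exact mem_pairOfPants (by linarith [norm_le_norm_add_two_I_add (u - 2 * Complex.I)])
    (by linarith [four_le_norm_sub_add (u - 2 * Complex.I)]) h1.ge

theorem continuousOn_sheetCircle (k : ℕ+) (j : ℤ) (n : ℕ+) :
    ContinuousOn (sheetCircle k j n) (Metric.sphere 0 1) := by
  unfold sheetCircle
  split_ifs
  · exact (continuousOn_sheetMap k _).comp (by fun_prop) fun u hu =>
      mem_pairOfPants_legOne (by simpa using hu)
  · exact (continuousOn_sheetMap k _).comp (by fun_prop) fun u hu =>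
      mem_pairOfPants_legTwo (by simpa using hu)
  · exact continuousOn_const

theorem continuous_sheetEarring (k : ℕ+) (j : ℤ) : Continuous (sheetEarring k j) := by
  unfold sheetEarring
  split_ifs
  · exact continuous_ofEarring
  · refine continuous_glueCircles (sheetCircle_neg_one k j) (continuousOn_sheetCircle k j) ?_
    intro O hO
    -- Only the two circles along which lifts of the `k`-th pants have their legs are mapped
    -- non-constantly.
    refine ((Set.finite_singleton (2 * k)).insert (2 * k + 1)).subset fun n hn => ?_
    by_contra h
    simp only [Set.mem_insert_iff, Set.mem_singleton_iff, not_or] at h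
    refine hn fun u _ => ?_
    simpa [sheetCircle, h.1, h.2] using mem_of_mem_nhds hO

theorem sheetEarring_mem_range (k : ℕ+) (j : ℤ) (h : hawaiianEarring) :
    sheetEarring k j h ∈ Set.range ofEarring := by
  by_cases hj : j = 0
  · rw [hj, sheetEarring_zero]
    exact ⟨h, rfl⟩
  · rw [sheetEarring, if_neg hj, glueCircles, sheetCircle]
    split_ifs
    exacts [sheetMap_mem_range _ _ _, sheetMap_mem_range _ _ _, ⟨_, rfl⟩]

/-! ### The height and the retraction of the cover -/

/-- The height function on a pair of pants that defines the cover. -/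
noncomputable def height (z : ℂ) : ℝ := legOneBump z - legTwoBump z

theorem continuous_height : Continuous height := continuous_legOneBump.sub continuous_legTwoBump

theorem height_outer {z : ℂ} (h : ‖z‖ = 4) : height z = 0 := by
  rw [height, legOneBump_of_norm_eq h, legTwoBump_of_norm_eq h, sub_zero]

theorem height_legOne {z : ℂ} (h : ‖z - 2 * Complex.I‖ = 1) : height z = 1 := by
  rw [height, legOneBump_of_eq h, legTwoBump_of_legOne (by linarith), sub_zero]

theorem height_legTwo {z : ℂ} (h : ‖z + 2 * Complex.I‖ = 1) : height z = -1 := by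
  rw [height, legTwoBump_of_eq h, legOneBump_of_legTwo (by linarith), zero_sub]

open Classical in
/-- The retraction of the cover to the earring and the pairs of pants of sheet `0` other than the
`k`-th one; the real number `s` determines the sheet of the point. -/
noncomputable def unwrap (k : ℕ+) (s : ℝ) : HawaiianPants → HawaiianPants :=
  HawaiianPants.lift (sheetEarring k (round s))
    (fun m z => if m = k then sheetMap k (round (s - height z)) z
      else if round s = 0 then ofPants m z else sheetEarring k (round s) (pantsToEarring m z))
    (fun m z hz => by
      by_cases hs : round s = 0
      · split_ifs with hm
        · rw [height_outer hz, sub_zero, hs, sheetMap_zero_outer k hz, sheetEarring_zero, hm]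
        · rw [hs, sheetEarring_zero, ofPants_outer m hz]
      · split_ifs with hm
        · rw [height_outer hz, sub_zero, sheetMap_outer k hs hz, sheetEarring_circlePt k hs,
            sheetCircle, hm, if_neg (self_ne_two_mul k), if_neg (self_ne_two_mul_add_one k)]
        · rw [pantsToEarring_outer m (by rw [hz]; norm_num)])
    (fun m z hz => by
      by_cases hs : round s = 0
      · split_ifs with hm
        -- In sheet `0` the first leg has height `1`, so it belongs to lift `-1`, whose map is the
        -- identity on that leg.
        · rw [height_legOne hz, round_sub_one, hs, zero_sub, sheetMap_legOne k hz,
            sheetEarring_zero, hm]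
        · rw [hs, sheetEarring_zero, ofPants_legOne m hz]
      · split_ifs with hm
        · rw [height_legOne hz, round_sub_one, sheetEarring_circlePt k hs, sheetCircle, hm,
            if_pos rfl, dir_of_norm_one hz, sub_add_cancel]
        · rw [pantsToEarring_legOne m (by rw [hz]; norm_num)])
    (fun m z hz => by
      by_cases hs : round s = 0
      · split_ifs with hm
        · rw [height_legTwo hz, sub_neg_eq_add, round_add_one, hs, zero_add, sheetMap_legTwo k hz,
            sheetEarring_zero, hm]
        · rw [hs, sheetEarring_zero, ofPants_legTwo m hz]
      · split_ifs with hm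
        · rw [height_legTwo hz, sub_neg_eq_add, round_add_one, sheetEarring_circlePt k hs,
            sheetCircle, hm, if_neg (two_mul_add_one_ne k), if_pos rfl, dir_of_norm_one hz,
            add_sub_cancel_right]
        · rw [pantsToEarring_legTwo m (by rw [hz]; norm_num)])

theorem unwrap_ofEarring (k : ℕ+) (s : ℝ) (h : hawaiianEarring) :
    unwrap k s (ofEarring h) = sheetEarring k (round s) h := rfl

theorem unwrap_ofPants_self (k : ℕ+) (s : ℝ) (z : pairOfPants) :
    unwrap k s (ofPants k z) = sheetMap k (round (s - height z)) z := if_pos rfl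

theorem unwrap_ofPants_of_ne {k m : ℕ+} (hm : m ≠ k) (s : ℝ) (z : pairOfPants) :
    unwrap k s (ofPants m z) = if round s = 0 then ofPants m z
      else sheetEarring k (round s) (pantsToEarring m z) := if_neg hm

/-- Here `k.succPNat` is `k + 1`, the largest remaining index. The pants of that index go into the
earring; any other point is either fixed or sent into the earring. -/
theorem unwrap_mem_pantsUpTo {k : ℕ} {p : HawaiianPants} (hp : p ∈ pantsUpTo (k + 1)) (s : ℝ) :
    unwrap k.succPNat s p ∈ pantsUpTo k := by
  have hr : ∀ q ∈ Set.range ofEarring, q ∈ pantsUpTo k := by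
    rintro _ ⟨h, rfl⟩
    exact ofEarring_mem_pantsUpTo k h
  rcases p.cases with ⟨h, rfl⟩ | ⟨m, z, rfl⟩
  · exact hr _ (sheetEarring_mem_range _ _ _)
  by_cases hm : m = k.succPNat
  · rw [hm, unwrap_ofPants_self]
    exact hr _ (sheetMap_mem_range _ _ _)
  · rw [unwrap_ofPants_of_ne hm]
    split_ifs
    · intro n hn hmem
      have := ofPants_mem_openPants.1 hmem
      refine hp n ?_ hmem
      refine lt_of_le_of_ne hn fun hkn => hm ?_
      rw [this.1]
      exact PNat.eq hkn.symm
    · exact hr _ (sheetEarring_mem_range _ _ _)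

open Classical in
/-- The map to the circle that measures the height in the `k`-th pair of pants. -/
noncomputable def heightMap (k : ℕ+) : HawaiianPants → Circle :=
  HawaiianPants.lift (fun _ => 1)
    (fun m z => if m = k then Circle.exp (2 * Real.pi * height z) else 1)
    (fun m z hz => by rw [height_outer hz]; simp)
    (fun m z hz => by rw [height_legOne hz]; simp)
    (fun m z hz => by rw [height_legTwo hz, mul_neg_one, Circle.exp_neg]; simp)

theorem heightMap_ofEarring (k : ℕ+) (h : hawaiianEarring) : heightMap k (ofEarring h) = 1 := rfl

theorem heightMap_ofPants_self (k : ℕ+) (z : pairOfPants) :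
    heightMap k (ofPants k z) = Circle.exp (2 * Real.pi * height z) := if_pos rfl

theorem heightMap_ofPants_of_ne {k m : ℕ+} (hm : m ≠ k) (z : pairOfPants) :
    heightMap k (ofPants m z) = 1 := if_neg hm

theorem continuous_heightMap (k : ℕ+) : Continuous (heightMap k) := by
  refine HawaiianPants.continuous_of_pieces continuous_const fun m => ?_
  by_cases hm : m = k
  · subst hm
    simp only [heightMap_ofPants_self]
    have := continuous_height
    fun_prop
  · simp only [heightMap_ofPants_of_ne hm]
    exact continuous_const

theorem exists_int_of_exp_eq {s t : ℝ}
    (h : Circle.exp (2 * Real.pi * s) = Circle.exp (2 * Real.pi * t)) : ∃ n : ℤ, s - t = n := by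
  obtain ⟨n, hn⟩ := Circle.exp_eq_exp.1 h
  refine ⟨n, ?_⟩
  have : 2 * Real.pi * (s - t - n) = 0 := by linarith
  have h2 : s - t - n = 0 := (mul_eq_zero.1 this).resolve_left (by positivity)
  linarith

/-- A continuous integer-valued function is locally constant, so locally one sheet map is used. -/
theorem ContinuousWithinAt.sheetMap_round {X : Type*} [TopologicalSpace X] {S : Set X} {x₀ : X}
    (hx : x₀ ∈ S) (k : ℕ+) {i : X → ℝ} {w : X → ℂ} (hi : ContinuousWithinAt i S x₀)
    (hint : ∀ x ∈ S, ∃ n : ℤ, i x = n) (hw : ContinuousWithinAt w S x₀)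
    (hwP : ∀ x ∈ S, w x ∈ pairOfPants) :
    ContinuousWithinAt (fun x => sheetMap k (round (i x)) (w x)) S x₀ := by
  have h1 : ContinuousWithinAt (fun x => sheetMap k (round (i x₀)) (w x)) S x₀ :=
    (continuousOn_sheetMap k _ _ (hwP x₀ hx)).comp hw hwP
  refine h1.congr_of_eventuallyEq ?_ rfl
  filter_upwards [Metric.tendsto_nhds.1 hi 1 one_pos, self_mem_nhdsWithin] with x hd hxS
  obtain ⟨a, ha⟩ := hint x hxS
  obtain ⟨b, hb⟩ := hint x₀ hx
  rw [ha, hb, Real.dist_eq] at hd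
  have hab : |a - b| < 1 := by exact_mod_cast hd
  rw [Int.abs_lt_one_iff] at hab
  rw [ha, hb, show a = b by omega]

/-! ### Continuity of the retraction along a lifted map -/

/-- The map `unwrap k` in a neighbourhood of the sheet `j`, as a map on the Hawaiian Pants. -/
noncomputable def unwrapSheet (k : ℕ+) (j : ℤ) (p : HawaiianPants) : HawaiianPants :=
  unwrap k (j + (heightMap k p : ℂ).arg / (2 * Real.pi)) p

theorem exp_two_pi_add_arg (j : ℤ) (c : Circle) :
    Circle.exp (2 * Real.pi * (j + (c : ℂ).arg / (2 * Real.pi))) = c := by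
  have h : 2 * Real.pi * (j + (c : ℂ).arg / (2 * Real.pi)) = (c : ℂ).arg + j * (2 * Real.pi) := by
    field_simp
    ring
  rw [h, Circle.exp_add, Circle.exp_arg, Circle.exp_int_mul_two_pi, mul_one]

/-- For `|s - j| < 1 / 2` the angle `2π(s - j)` is the principal argument of the height, so the
point of the Hawaiian Pants and `j` determine `s`. -/
theorem unwrapSheet_eq {k : ℕ+} {j : ℤ} {s : ℝ} {p : HawaiianPants} (hs : |s - j| < 1 / 2)
    (hp : Circle.exp (2 * Real.pi * s) = heightMap k p) :
    (heightMap k p : ℂ) ∈ Complex.slitPlane ∧ unwrapSheet k j p = unwrap k s p := by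
  have hpi := Real.pi_pos
  rw [abs_lt] at hs
  have h1 : (heightMap k p : ℂ).arg = 2 * Real.pi * (s - j) := by
    have h : Circle.exp (2 * Real.pi * (s - j)) = heightMap k p := by
      rw [← hp, show 2 * Real.pi * s = 2 * Real.pi * (s - j) + j * (2 * Real.pi) by ring,
        Circle.exp_add, Circle.exp_int_mul_two_pi, mul_one]
    rw [← h]
    exact Circle.arg_exp (by nlinarith) (by nlinarith)
  constructor
  · rw [Complex.mem_slitPlane_iff_arg, h1]
    refine ⟨by nlinarith, by simp⟩
  · rw [unwrapSheet, h1]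
    congr 1
    field_simp
    ring

/-- The circles `C_n`, `C_{2n}`, `C_{2n+1}` have index below `2k` when `n < k`, and in the sheets
other than `0` such circles are collapsed. This is why pants are removed from the highest index
down. -/
theorem sheetEarring_pantsToEarring {k n : ℕ+} (hn : n < k) {j : ℤ} (hj : j ≠ 0)
    (z : ℂ) : sheetEarring k j (pantsToEarring n z) = pantsBase := by
  have h : ∀ m : ℕ+, (m : ℕ) ≤ 2 * n + 1 → ∀ w, sheetEarring k j (circlePt m w) = pantsBase := by
    intro m hm w
    have hn' : (n : ℕ) < k := hn
    rw [sheetEarring_circlePt k hj, sheetCircle, if_neg, if_neg]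
    all_goals
      intro h
      have hv := congrArg PNat.val h
      simp only [PNat.add_coe, PNat.mul_coe, PNat.val_ofNat] at hv
      omega
  unfold pantsToEarring
  split_ifs
  · exact h _ (by simp) _
  · exact h _ (by simp) _
  · exact h _ (by omega) _

theorem continuousOn_unwrapSheet (k : ℕ) (j : ℤ) : ContinuousOn (unwrapSheet k.succPNat j)
    ({p | (heightMap k.succPNat p : ℂ) ∈ Complex.slitPlane} ∩ pantsUpTo (k + 1)) := by
  set K := k.succPNat with hK
  have hO : IsOpen {p | (heightMap K p : ℂ) ∈ Complex.slitPlane} :=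
    Complex.isOpen_slitPlane.preimage (continuous_subtype_val.comp (continuous_heightMap K))
  refine HawaiianPants.continuousOn_of_pieces hO (isClosed_pantsUpTo _) ?_ fun m => ?_
  · have : (fun h => unwrapSheet K j (ofEarring h)) = sheetEarring K j := by
      ext h
      simp [unwrapSheet, unwrap_ofEarring, heightMap_ofEarring]
    rw [this]
    exact (continuous_sheetEarring K j).continuousOn
  by_cases hm : m = K
  · rw [hm]
    simp only [unwrapSheet, unwrap_ofPants_self]
    intro z hz
    refine ContinuousWithinAt.sheetMap_round hz K ?_ ?_
      continuous_subtype_val.continuousWithinAt fun x _ => x.2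
    · have h1 : ContinuousAt (fun x : pairOfPants => (heightMap K (ofPants K x) : ℂ).arg) z :=
        ContinuousAt.comp (f := fun x : pairOfPants => (heightMap K (ofPants K x) : ℂ))
          (Complex.continuousAt_arg hz.1) (continuous_subtype_val.comp
            ((continuous_heightMap K).comp (continuous_ofPants K))).continuousAt
      exact ((continuousAt_const.add (h1.div_const _)).sub
        (continuous_height.comp continuous_subtype_val).continuousAt).continuousWithinAt
    · intro x _
      refine exists_int_of_exp_eq ?_
      rw [exp_two_pi_add_arg, heightMap_ofPants_self]
  · simp only [unwrapSheet, unwrap_ofPants_of_ne hm, heightMap_ofPants_of_ne hm, Circle.coe_one,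
      Complex.arg_one, zero_div, add_zero, round_intCast]
    by_cases hj : j = 0
    · simp only [hj, if_true]
      exact (continuous_ofPants m).continuousOn
    simp only [hj, if_false]
    -- Pants of smaller index collapse to the base point. Of pants of larger index, `pantsUpTo`
    -- retains only the boundary circles, where `pantsToEarring` is continuous.
    by_cases hmK : m < K
    · simp only [sheetEarring_pantsToEarring hmK hj]
      exact continuousOn_const
    · refine (continuous_sheetEarring K j).comp_continuousOn
        ((continuousOn_pantsToEarring m).comp continuous_subtype_val.continuousOn ?_)
      intro z hz
      refine ⟨?_, z.2⟩
      have hlt : K < m := lt_of_le_of_ne (not_lt.1 hmK) (Ne.symm hm)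
      have hint : (z : ℂ) ∉ pantsInterior := fun h =>
        hz.2 m (by have : (K : ℕ) < m := hlt; simpa [hK] using this)
          (ofPants_mem_openPants.2 ⟨rfl, h⟩)
      rcases mem_pantsInterior_or z with h | h | h | h
      · exact absurd h hint
      · exact Or.inr (Or.inr (by rw [h]; norm_num))
      · exact Or.inl (by rw [h]; norm_num)
      · exact Or.inr (Or.inl (by rw [h]; norm_num))

/-- The pair `(φ, f)` is a lift of `f` to the cover. Over the interior of the removed pants,
`planeCoord` gives a direct formula; at all other points `φ` is an integer `j`, and nearby the map
factors through `unwrapSheet` for that `j`. -/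
theorem continuous_unwrap_comp {X : Type*} [TopologicalSpace X] {k : ℕ} {f : X → HawaiianPants}
    (hf : Continuous f) (hfk : ∀ x, f x ∈ pantsUpTo (k + 1)) {φ : X → ℝ} (hφ : Continuous φ)
    (hφf : ∀ x, Circle.exp (2 * Real.pi * φ x) = heightMap k.succPNat (f x)) :
    Continuous fun x => unwrap k.succPNat (φ x) (f x) := by
  set K := k.succPNat with hK
  rw [continuous_iff_continuousAt]
  intro x₀
  by_cases hx : f x₀ ∈ openPants K
  · have hS : IsOpen (f ⁻¹' openPants K) := (isOpen_openPants K).preimage hf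
    refine ContinuousWithinAt.continuousAt ?_ (hS.mem_nhds hx)
    have hw : ContinuousWithinAt (fun x => planeCoord (f x)) (f ⁻¹' openPants K) x₀ :=
      ((continuousOn_planeCoord K).comp hf.continuousOn (fun _ h => h)) x₀ hx
    have hrep : ∀ x ∈ f ⁻¹' openPants K, ∃ z : pairOfPants, f x = ofPants K z ∧
        planeCoord (f x) = z := by
      intro x hx
      obtain ⟨z, hz, hz'⟩ := mem_openPants_iff.1 hx
      exact ⟨z, hz, by rw [hz, planeCoord_ofPants hz']⟩
    have key : ContinuousWithinAt (fun x => sheetMap K (round (φ x - height (planeCoord (f x))))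
        (planeCoord (f x))) (f ⁻¹' openPants K) x₀ := by
      refine ContinuousWithinAt.sheetMap_round (S := f ⁻¹' openPants K) hx K
        (hφ.continuousWithinAt.sub (continuous_height.continuousAt.comp_continuousWithinAt hw))
        ?_ hw ?_
      · intro x hx
        obtain ⟨z, hz, hz'⟩ := hrep x hx
        refine exists_int_of_exp_eq ?_
        rw [hφf, hz', hz, heightMap_ofPants_self]
      · intro x hx
        obtain ⟨z, hz, hz'⟩ := hrep x hx
        rw [hz']
        exact z.2
    have heq : ∀ x ∈ f ⁻¹' openPants K, unwrap K (φ x) (f x) =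
        sheetMap K (round (φ x - height (planeCoord (f x)))) (planeCoord (f x)) := by
      intro x hx
      obtain ⟨z, hz, hz'⟩ := hrep x hx
      rw [hz', hz, unwrap_ofPants_self]
    exact key.congr heq (heq x₀ hx)
  · have hint : ∃ j : ℤ, φ x₀ = j := by
      have h1 : heightMap K (f x₀) = 1 := by
        rcases exists_eq_ofEarring_or (f x₀) with ⟨h, hh⟩ | ⟨m, z, hz, hz'⟩
        · rw [hh, heightMap_ofEarring]
        · rw [hz, heightMap_ofPants_of_ne]
          rintro rfl
          exact hx (by rw [hz]; exact ofPants_mem_openPants.2 ⟨rfl, hz'⟩)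
      have := exists_int_of_exp_eq (s := φ x₀) (t := 0) (by rw [hφf, h1]; simp)
      simpa using this
    obtain ⟨j, hj⟩ := hint
    have hN : ∀ᶠ x in 𝓝 x₀, |φ x - j| < 1 / 2 := by
      have := Metric.tendsto_nhds.1 (hφ.tendsto x₀) (1 / 2) (by norm_num)
      simpa [hj, Real.dist_eq] using this
    have hsl : ∀ x, |φ x - j| < 1 / 2 →
        f x ∈ {p | (heightMap K p : ℂ) ∈ Complex.slitPlane} ∩ pantsUpTo (k + 1) := fun x hx =>
      ⟨(unwrapSheet_eq hx (hφf x)).1, hfk x⟩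
    have h1 : ContinuousAt (fun x => unwrapSheet K j (f x)) x₀ := by
      have h2 := continuousOn_unwrapSheet k j (f x₀) (hsl x₀ (by rw [hj]; norm_num))
      refine h2.tendsto.comp (tendsto_nhdsWithin_iff.2 ⟨hf.continuousAt, ?_⟩)
      exact hN.mono hsl
    exact h1.congr (hN.mono fun x hx => (unwrapSheet_eq hx (hφf x)).2)

/-! ### Moving a disk into the earring -/

/-- The plane is simply connected, so the map lifts through the covering of the circle by the line.
Maps on the disk are extended to the plane by `diskProj`. -/
theorem exists_lift_of_continuous {F : ℂ → Circle} (hF : Continuous F) :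
    ∃ φ : ℂ → ℝ, Continuous φ ∧ ∀ z, Circle.exp (2 * Real.pi * φ z) = F z := by
  obtain ⟨φ, ⟨-, hφ⟩, -⟩ := Circle.isCoveringMap_exp.existsUnique_continuousMap_lifts ⟨F, hF⟩ 0
    (F 0 : ℂ).arg (Circle.exp_arg _)
  refine ⟨fun z => φ z / (2 * Real.pi), by fun_prop, fun z => ?_⟩
  rw [mul_div_cancel₀ _ (by positivity)]
  exact congrFun hφ z

/-- The projection of the plane to the closed unit disk. -/
noncomputable def diskProj (z : ℂ) : Metric.closedBall (0 : ℂ) 1 := ⟨unitClamp z, by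
  rw [mem_closedBall_zero_iff, unitClamp, norm_div, Complex.norm_real,
    Real.norm_of_nonneg (by positivity)]
  exact div_le_one_of_le₀ (le_max_left _ _) (by positivity)⟩

theorem continuous_diskProj : Continuous diskProj := continuous_unitClamp.subtype_mk _

theorem diskProj_coe (z : Metric.closedBall (0 : ℂ) 1) : diskProj z = z := by
  refine Subtype.ext ?_
  have h : ‖(z : ℂ)‖ ≤ 1 := mem_closedBall_zero_iff.1 z.2
  simp [diskProj, unitClamp, h]

theorem exists_disk_in_pantsUpTo_pred {k : ℕ} (f : C(Metric.closedBall (0 : ℂ) 1, HawaiianPants))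
    (hf : ∀ z, f z ∈ pantsUpTo (k + 1))
    (hb : ∀ z : Metric.closedBall (0 : ℂ) 1, ‖(z : ℂ)‖ = 1 → f z ∈ Set.range ofEarring) :
    ∃ g : C(Metric.closedBall (0 : ℂ) 1, HawaiianPants), (∀ z, g z ∈ pantsUpTo k) ∧
      ∀ z : Metric.closedBall (0 : ℂ) 1, ‖(z : ℂ)‖ = 1 → g z = f z := by
  obtain ⟨φ₀, hφ₀, hφf₀⟩ := exists_lift_of_continuous (F := fun z => heightMap k.succPNat
    (f (diskProj z))) ((continuous_heightMap _).comp (f.continuous.comp continuous_diskProj))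
  have hint : ∀ z : ℂ, ‖z‖ = 1 → ∃ n : ℤ, φ₀ z = n := fun z hz => by
    obtain ⟨h, hh⟩ := hb ⟨z, by simp [hz]⟩ hz
    have h1 := hφf₀ (⟨z, by simp [hz]⟩ : Metric.closedBall (0 : ℂ) 1)
    rw [diskProj_coe, ← hh, heightMap_ofEarring] at h1
    have := exists_int_of_exp_eq (s := φ₀ z) (t := 0) (by rw [h1]; simp)
    simpa using this
  -- On the boundary the lift is integer-valued, and the circle is connected.
  have hconst : ∀ z : ℂ, ‖z‖ = 1 → φ₀ z = φ₀ 1 := fun z hz => by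
    have hpre : IsPreconnected (Metric.sphere (0 : ℂ) 1) :=
      isPreconnected_sphere (by rw [Complex.rank_real_complex]; norm_num) _ _
    have hr : ContinuousOn (fun z => round (φ₀ z)) (Metric.sphere (0 : ℂ) 1) := by
      intro z hz
      have h1 : ContinuousWithinAt (fun _ => round (φ₀ z)) (Metric.sphere (0 : ℂ) 1) z :=
        continuousWithinAt_const
      refine h1.congr_of_eventuallyEq ?_ rfl
      filter_upwards [nhdsWithin_le_nhds (Metric.tendsto_nhds.1 (hφ₀.tendsto z) 1 one_pos),
        self_mem_nhdsWithin] with x hd hx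
      obtain ⟨a, ha⟩ := hint x (by simpa using hx)
      obtain ⟨b, hb⟩ := hint z (by simpa using hz)
      rw [ha, hb, Real.dist_eq] at hd
      have hab : |a - b| < 1 := by exact_mod_cast hd
      rw [Int.abs_lt_one_iff] at hab
      rw [ha, hb, show a = b by omega]
    have := hpre.constant hr (x := z) (y := 1) (by simpa using hz) (by simp)
    obtain ⟨a, ha⟩ := hint z hz
    obtain ⟨b, hb⟩ := hint 1 (by simp)
    simp only [ha, hb, round_intCast] at this ⊢
    exact_mod_cast this
  obtain ⟨c, hc⟩ := hint 1 (by simp)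
  -- Subtracting the integer `c` moves the boundary to sheet `0`, where the retraction fixes the
  -- earring.
  let φ : Metric.closedBall (0 : ℂ) 1 → ℝ := fun z => φ₀ z - c
  have hφ : Continuous φ := by fun_prop
  have hφf : ∀ z, Circle.exp (2 * Real.pi * φ z) = heightMap k.succPNat (f z) := fun z => by
    have := hφf₀ z
    rw [diskProj_coe] at this
    rw [← this, show 2 * Real.pi * φ₀ z = 2 * Real.pi * φ z + c * (2 * Real.pi) by
      simp only [φ]; ring, Circle.exp_add, Circle.exp_int_mul_two_pi, mul_one]
  refine ⟨⟨_, continuous_unwrap_comp f.continuous hf hφ hφf⟩, fun z =>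
    unwrap_mem_pantsUpTo (hf z) _, fun z hz => ?_⟩
  obtain ⟨h, hh⟩ := hb z hz
  have h0 : φ z = 0 := by simp only [φ, hconst z hz, hc, sub_self]
  rw [ContinuousMap.coe_mk, h0, ← hh, unwrap_ofEarring, round_zero, sheetEarring_zero]

theorem pantsUpTo_zero_subset : pantsUpTo 0 ⊆ Set.range ofEarring := fun p hp => by
  rcases exists_eq_ofEarring_or p with ⟨h, rfl⟩ | ⟨n, z, rfl, hz⟩
  · exact ⟨h, rfl⟩
  · exact absurd (ofPants_mem_openPants.2 ⟨rfl, hz⟩) (hp n n.pos)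

theorem exists_disk_in_earring (f : C(Metric.closedBall (0 : ℂ) 1, HawaiianPants))
    (hb : ∀ z : Metric.closedBall (0 : ℂ) 1, ‖(z : ℂ)‖ = 1 → f z ∈ Set.range ofEarring) :
    ∃ g : C(Metric.closedBall (0 : ℂ) 1, hawaiianEarring),
      ∀ z : Metric.closedBall (0 : ℂ) 1, ‖(z : ℂ)‖ = 1 → ofEarring (g z) = f z := by
  have key : ∀ (k : ℕ) (f : C(Metric.closedBall (0 : ℂ) 1, HawaiianPants)),
      (∀ z, f z ∈ pantsUpTo k) →
      (∀ z : Metric.closedBall (0 : ℂ) 1, ‖(z : ℂ)‖ = 1 → f z ∈ Set.range ofEarring) →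
      ∃ g : C(Metric.closedBall (0 : ℂ) 1, HawaiianPants), (∀ z, g z ∈ pantsUpTo 0) ∧
        ∀ z : Metric.closedBall (0 : ℂ) 1, ‖(z : ℂ)‖ = 1 → g z = f z := by
    intro k
    induction k with
    | zero => exact fun f hf _ => ⟨f, hf, fun _ _ => rfl⟩
    | succ k ih =>
      intro f hf hb
      obtain ⟨g, hg, hgf⟩ := exists_disk_in_pantsUpTo_pred f hf hb
      obtain ⟨g', hg', hgg'⟩ := ih g hg fun z hz => by rw [hgf z hz]; exact hb z hz
      exact ⟨g', hg', fun z hz => (hgg' z hz).trans (hgf z hz)⟩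
  obtain ⟨k, hk⟩ := exists_subset_pantsUpTo (isCompact_range f.continuous)
  obtain ⟨g, hg, hgf⟩ := key k f (fun z => hk ⟨z, rfl⟩) hb
  have hgr : ∀ z, ∃ h, ofEarring h = g z := fun z => pantsUpTo_zero_subset (hg z)
  -- On the image of the earring `toEarring` is a continuous inverse of `ofEarring`, so the disk is
  -- continuous for the topology of the earring.
  refine ⟨⟨fun z => toEarring (g z), ?_⟩, fun z hz => ?_⟩
  · refine continuousOn_toEarring.comp_continuous g.continuous fun z => ?_
    obtain ⟨h, hh⟩ := hgr z
    rw [← hh]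
    exact ofEarring_mem_collar h
  · obtain ⟨h, hh⟩ := hgr z
    rw [ContinuousMap.coe_mk, ← hgf z hz, ← hh, toEarring_ofEarring]

/-! ### Maps of the earring into a small neighbourhood of a point -/

/-- The retraction of the unit circle to a short arc around `-1`. -/
noncomputable def foldCircle (η : ℝ) (u : ℂ) : ℂ :=
  ⟨-√(1 - (max (-η) (min η u.im)) ^ 2), max (-η) (min η u.im)⟩

theorem continuous_foldCircle (η : ℝ) : Continuous (foldCircle η) := by
  have : foldCircle η = fun u => Complex.equivRealProdCLM.symm
      (-√(1 - (max (-η) (min η u.im)) ^ 2), max (-η) (min η u.im)) := by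
    ext u : 1
    rw [Complex.equivRealProdCLM_symm_apply]
    apply Complex.ext <;> simp [foldCircle]
  rw [this]
  fun_prop

theorem foldCircle_of_re_nonpos {η : ℝ} {u : ℂ} (hu : ‖u‖ = 1) (hre : u.re ≤ 0)
    (him : |u.im| ≤ η) : foldCircle η u = u := by
  have h1 : max (-η) (min η u.im) = u.im := by
    rw [min_eq_right (abs_le.1 him).2, max_eq_right (abs_le.1 him).1]
  have h2 : u.re ^ 2 + u.im ^ 2 = 1 := by
    have := Complex.normSq_eq_norm_sq u
    rw [hu, Complex.normSq_apply] at this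
    linarith
  apply Complex.ext
  · simp only [foldCircle, h1]
    rw [show 1 - u.im ^ 2 = (-u.re) ^ 2 by linarith, Real.sqrt_sq (by linarith), neg_neg]
  · simp only [foldCircle, h1]

theorem abs_clamp_le {η : ℝ} (h0 : 0 ≤ η) (x : ℝ) : |max (-η) (min η x)| ≤ η :=
  abs_le.2 ⟨le_max_left _ _, max_le (by linarith) (min_le_left _ _)⟩

theorem norm_foldCircle {η : ℝ} (h0 : 0 ≤ η) (h1 : η ≤ 1) (u : ℂ) : ‖foldCircle η u‖ = 1 := by
  have hb := abs_clamp_le h0 u.im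
  have hb2 : (max (-η) (min η u.im)) ^ 2 ≤ 1 := (sq_le_one_iff_abs_le_one _).2 (hb.trans h1)
  have : Complex.normSq (foldCircle η u) = 1 := by
    rw [Complex.normSq_apply]
    simp only [foldCircle]
    rw [neg_mul_neg, Real.mul_self_sqrt (by linarith)]
    ring
  rw [Complex.normSq_eq_norm_sq] at this
  exact (pow_eq_one_iff_of_nonneg (norm_nonneg _) two_ne_zero).1 this

/-- With `b` the clamped imaginary part, the real and imaginary parts of the difference are bounded
by `|b|`, since `1 - √(1 - b²) ≤ |b|`. -/
theorem norm_foldCircle_add_one_le {η : ℝ} (h0 : 0 ≤ η) (h1 : η ≤ 1) (u : ℂ) :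
    ‖foldCircle η u + 1‖ ≤ 2 * η := by
  have hb := abs_clamp_le h0 u.im
  set b := max (-η) (min η u.im) with hbdef
  have hb1 : |b| ≤ 1 := hb.trans h1
  have hs1 : √(1 - b ^ 2) ≤ 1 := Real.sqrt_le_one.2 (by nlinarith [sq_nonneg b])
  have hs2 : 1 - |b| ≤ √(1 - b ^ 2) := by
    refine Real.le_sqrt_of_sq_le ?_
    rw [← sq_abs b]
    nlinarith [abs_nonneg b]
  have hre : (foldCircle η u + 1).re = 1 - √(1 - b ^ 2) := by
    simp [foldCircle, ← hbdef]; ring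
  have him : (foldCircle η u + 1).im = b := by simp [foldCircle, ← hbdef]
  have := Complex.norm_le_abs_re_add_abs_im (foldCircle η u + 1)
  rw [hre, him, abs_of_nonneg (by linarith)] at this
  linarith

theorem foldCircle_neg_one {η : ℝ} (h0 : 0 ≤ η) : foldCircle η (-1) = -1 :=
  foldCircle_of_re_nonpos (by simp) (by simp) (by simpa using h0)

theorem eventually_foldCircle_eq {η : ℝ} (h0 : 0 < η) :
    ∀ᶠ u in 𝓝 (-1 : ℂ), ‖u‖ = 1 → foldCircle η u = u := by
  have h1 : ∀ᶠ u in 𝓝 (-1 : ℂ), u.re < 0 :=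
    (isOpen_lt Complex.continuous_re continuous_const).mem_nhds (by simp)
  have h2 : ∀ᶠ u in 𝓝 (-1 : ℂ), |u.im| < η :=
    (isOpen_lt (Complex.continuous_im.abs) continuous_const).mem_nhds (by simpa using h0)
  filter_upwards [h1, h2] with u h1 h2 hu
  exact foldCircle_of_re_nonpos hu h1.le h2.le

theorem continuousOn_circlePt_comp (n : ℕ+) {f : ℂ → ℂ} (hf : Continuous f) {s : Set ℂ}
    (h : ∀ u ∈ s, ‖f u‖ = 1) : ContinuousOn (fun u => circlePt n (f u)) s :=
  (continuousOn_circlePt n).comp hf.continuousOn fun u hu h0 => by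
    have := h u hu
    rw [show f u = 0 from h0] at this
    simp at this

theorem norm_circlePt_le (n : ℕ+) (u : ℂ) : ‖(circlePt n u : ℂ)‖ ≤ ‖dir u + 1‖ / n := by
  rw [circlePt_coe, show (((n : ℝ)⁻¹ : ℝ) : ℂ) + (((n : ℝ)⁻¹ : ℝ) : ℂ) * dir u =
    (((n : ℝ)⁻¹ : ℝ) : ℂ) * (dir u + 1) by ring, norm_mul, Complex.norm_real,
    Real.norm_of_nonneg (by positivity)]
  exact (inv_mul_eq_div _ _).le

theorem finite_le_two_div {ε : ℝ} (hε : 0 < ε) : {n : ℕ+ | ε ≤ 2 / (n : ℝ)}.Finite := by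
  refine (Set.finite_Icc 1 (Nat.succPNat ⌈2 / ε⌉₊)).subset fun n hn => ⟨one_le, ?_⟩
  have hn0 : (0 : ℝ) < n := by exact_mod_cast n.pos
  have h1 : (n : ℝ) ≤ 2 / ε := by
    rw [le_div_iff₀ hε, mul_comm]
    exact (le_div_iff₀ hn0).1 hn
  have h2 : (n : ℕ) ≤ ⌈2 / ε⌉₊ := by exact_mod_cast h1.trans (Nat.le_ceil _)
  exact PNat.coe_le_coe _ _ |>.1 (by simp; omega)

/-- Circles of diameter `2 / n < ε` already lie in the neighbourhood and are fixed; the finitely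
many others are folded onto short arcs at the base point. -/
theorem exists_retraction_of_eq_zero {h₀ : hawaiianEarring} (h0 : (h₀ : ℂ) = 0)
    {N : Set hawaiianEarring} (hN : N ∈ 𝓝 h₀) : ∃ r : hawaiianEarring → hawaiianEarring,
      Continuous r ∧ (∀ y, r y ∈ N) ∧ ∀ᶠ y in 𝓝 h₀, r y = y := by
  classical
  have hbase : h₀ = earringBase := Subtype.ext (by rw [h0, earringBase_coe])
  obtain ⟨ε, hε, hεN⟩ := Metric.mem_nhds_iff.1 hN
  have hball : ∀ y : hawaiianEarring, ‖(y : ℂ)‖ < ε → y ∈ N := fun y hy => hεN (by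
    rw [Metric.mem_ball, Subtype.dist_eq, h0, dist_zero_right]; exact hy)
  set η : ℝ := min 1 (ε / 3) with hη
  have hη0 : 0 < η := lt_min one_pos (by linarith)
  have hη1 : η ≤ 1 := min_le_left _ _
  have hηε : 2 * η < ε := by linarith [min_le_right 1 (ε / 3)]
  let φ : ℕ+ → ℂ → hawaiianEarring := fun n u =>
    if ε ≤ 2 / (n : ℝ) then circlePt n (foldCircle η u) else circlePt n u
  have hb : ∀ n, φ n (-1) = earringBase := fun n => by
    simp only [φ, foldCircle_neg_one hη0.le, circlePt_neg_one, ite_self]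
  have hdir : ∀ u, ‖dir u + 1‖ ≤ 2 := fun u => by
    have := norm_add_le (dir u) 1
    rw [norm_dir, norm_one] at this
    linarith
  refine ⟨glueCircles φ, continuous_glueCircles hb (fun n => ?_) fun O hO => ?_, fun y => ?_, ?_⟩
  · simp only [φ]
    split_ifs
    · exact continuousOn_circlePt_comp n (continuous_foldCircle η)
        fun u _ => norm_foldCircle hη0.le hη1 u
    · exact continuousOn_circlePt_comp n continuous_id fun u hu => by simpa using hu
  · obtain ⟨δ, hδ, hδO⟩ := Metric.mem_nhds_iff.1 hO
    refine ((finite_le_two_div hε).union (finite_le_two_div hδ)).subset fun n hn => ?_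
    by_contra hcon
    simp only [Set.mem_union, Set.mem_ofPred_eq, not_or, not_le] at hcon
    refine hn fun u _ => hδO ?_
    simp only [φ, if_neg (not_le.2 hcon.1)]
    rw [Metric.mem_ball, Subtype.dist_eq, earringBase_coe, dist_zero_right]
    refine (norm_circlePt_le n u).trans_lt (lt_of_le_of_lt ?_ hcon.2)
    gcongr
    exact hdir u
  · have hn1 : (1 : ℝ) ≤ (earringIdx y : ℕ) := by exact_mod_cast (earringIdx y).pos
    rw [glueCircles]
    generalize (earringIdx y : ℂ) * y - 1 = u
    refine hball _ ?_
    simp only [φ]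
    split_ifs with hn
    · refine (norm_circlePt_le _ _).trans_lt ?_
      rw [dir_of_norm_one (norm_foldCircle hη0.le hη1 u)]
      refine (div_le_self (norm_nonneg _) hn1).trans_lt ?_
      linarith [norm_foldCircle_add_one_le hη0.le hη1 u]
    · refine (norm_circlePt_le _ _).trans_lt (lt_of_le_of_lt ?_ (not_le.1 hn))
      gcongr
      exact hdir u
  · have h1 : ∀ n : ℕ+, ∀ᶠ y : hawaiianEarring in 𝓝 h₀, ‖(n : ℂ) * y - 1‖ = 1 →
        foldCircle η ((n : ℂ) * y - 1) = (n : ℂ) * y - 1 := fun n => by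
      have hc : Continuous fun y : hawaiianEarring => (n : ℂ) * y - 1 := by fun_prop
      have := hc.continuousAt (x := h₀)
      rw [ContinuousAt, h0, mul_zero, zero_sub] at this
      exact this.eventually (eventually_foldCircle_eq hη0)
    filter_upwards [(eventually_all_finite (finite_le_two_div hε)).2 fun n _ => h1 n] with y hy
    simp only [glueCircles, φ]
    split_ifs with hn
    · rw [hy _ hn (norm_earringIdx_mul_sub_one y), ← eq_circlePt_earringIdx]
    · rw [← eq_circlePt_earringIdx]

/-- The circle through the point is folded onto a short arc around it; every other circle goes to
the image of the base point. -/
theorem exists_retraction_of_ne_zero {h₀ : hawaiianEarring} (h0 : (h₀ : ℂ) ≠ 0)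
    {N : Set hawaiianEarring} (hN : N ∈ 𝓝 h₀) : ∃ r : hawaiianEarring → hawaiianEarring,
      Continuous r ∧ (∀ y, r y ∈ N) ∧ ∀ᶠ y in 𝓝 h₀, r y = y := by
  classical
  set n := earringIdx h₀ with hn
  set u₀ : ℂ := (n : ℂ) * h₀ - 1 with hu₀
  have hu1 : ‖u₀‖ = 1 := norm_earringIdx_mul_sub_one h₀
  have hu0 : u₀ ≠ 0 := norm_pos_iff.1 (by rw [hu1]; exact one_pos)
  have hh : h₀ = circlePt n u₀ := eq_circlePt_earringIdx h₀
  have hstar : u₀ * star u₀ = 1 := by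
    have := Complex.mul_conj u₀
    rw [Complex.normSq_eq_norm_sq, hu1] at this
    simpa using this
  have hcont : ContinuousAt (circlePt n) u₀ :=
    (continuousOn_circlePt n).continuousAt (isOpen_compl_singleton.mem_nhds hu0)
  obtain ⟨δ, hδ, hδN⟩ := Metric.mem_nhds_iff.1 (hcont (hh ▸ hN))
  set η : ℝ := min 1 (δ / 3) with hη
  have hη0 : 0 < η := lt_min one_pos (by linarith)
  have hη1 : η ≤ 1 := min_le_left _ _
  have hηδ : 2 * η < δ := by linarith [min_le_right 1 (δ / 3)]
  -- The fold around `-1`, conjugated by the rotation that takes `u₀` to `-1`.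
  let ψ : ℂ → ℂ := fun u => -(u₀ * foldCircle η (-(u * star u₀)))
  have hψ : Continuous ψ := by
    have := continuous_foldCircle η
    fun_prop
  have hψ1 : ∀ u, ‖ψ u‖ = 1 := fun u => by
    simp only [ψ, norm_neg, norm_mul, hu1, norm_foldCircle hη0.le hη1, mul_one]
  have hψN : ∀ u, circlePt n (ψ u) ∈ N := fun u => hδN (by
    rw [Metric.mem_ball, dist_eq_norm]
    have : ψ u - u₀ = -(u₀ * (foldCircle η (-(u * star u₀)) + 1)) := by simp only [ψ]; ring
    rw [this, norm_neg, norm_mul, hu1, one_mul]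
    exact (norm_foldCircle_add_one_le hη0.le hη1 _).trans_lt hηδ)
  let φ : ℕ+ → ℂ → hawaiianEarring := fun m u =>
    if m = n then circlePt n (ψ u) else circlePt n (ψ (-1))
  have hb : ∀ m, φ m (-1) = circlePt n (ψ (-1)) := fun m => by simp only [φ, ite_self]
  refine ⟨glueCircles φ, continuous_glueCircles hb (fun m => ?_) fun O hO => ?_, fun y => ?_, ?_⟩
  · simp only [φ]
    split_ifs
    · exact continuousOn_circlePt_comp n hψ fun u _ => hψ1 u
    · exact continuousOn_const
  · refine (Set.finite_singleton n).subset fun m hm => ?_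
    by_contra hcon
    refine hm fun u _ => ?_
    simp only [φ, if_neg (show m ≠ n from hcon)]
    exact mem_of_mem_nhds hO
  · rw [glueCircles]
    simp only [φ]
    split_ifs
    · exact hψN _
    · exact hψN _
  · have hc : Continuous fun y : hawaiianEarring => -(((n : ℂ) * y - 1) * star u₀) := by fun_prop
    have h1 := hc.continuousAt (x := h₀)
    rw [ContinuousAt, ← hu₀, hstar] at h1
    filter_upwards [eventually_earringIdx_eq h0, h1.eventually (eventually_foldCircle_eq hη0)]
      with y hy hfold
    have hy1 : ‖(n : ℂ) * y - 1‖ = 1 := by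
      have := norm_earringIdx_mul_sub_one y
      rwa [hy.2] at this
    have hf := hfold (by rw [norm_neg, norm_mul, hy1, norm_star, hu1, mul_one])
    simp only [glueCircles, φ, hy.2, ← hn, if_true, ψ, hf]
    rw [show -(u₀ * -(((n : ℂ) * y - 1) * star u₀)) = ((n : ℂ) * y - 1) * (u₀ * star u₀) by ring,
      hstar, mul_one]
    have := eq_circlePt_earringIdx y
    rw [hy.2] at this
    exact this.symm

theorem exists_earring_retraction (h₀ : hawaiianEarring) {N : Set hawaiianEarring}
    (hN : N ∈ 𝓝 h₀) : ∃ r : hawaiianEarring → hawaiianEarring,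
      Continuous r ∧ (∀ y, r y ∈ N) ∧ ∀ᶠ y in 𝓝 h₀, r y = y := by
  by_cases h0 : (h₀ : ℂ) = 0
  · exact exists_retraction_of_eq_zero h0 hN
  · exact exists_retraction_of_ne_zero h0 hN

/-! ### Assembling the disks -/

/-- The point of the unit circle in the direction of a complex number. -/
noncomputable def dirSphere (z : ℂ) : Metric.sphere (0 : ℂ) 1 := ⟨dir z, by simp [norm_dir]⟩

/-- The disk `G` is shrunk to radius `1 / 2`, and the homotopy `L` fills the surrounding annulus
radially. -/
theorem exists_disk_of_annulus {Z : Type*} [TopologicalSpace Z] {S : Set Z}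
    {G : Metric.closedBall (0 : ℂ) 1 → Z} (hG : Continuous G) (hGS : ∀ z, G z ∈ S)
    {L : unitInterval × Metric.sphere (0 : ℂ) 1 → Z} (hL : Continuous L) (hLS : ∀ x, L x ∈ S)
    (hGL : ∀ w : Metric.sphere (0 : ℂ) 1, L (0, w) = G ⟨w, Metric.sphere_subset_closedBall w.2⟩) :
    ∃ g : C(Metric.closedBall (0 : ℂ) 1, S), ∀ w : Metric.sphere (0 : ℂ) 1,
      (g ⟨w, Metric.sphere_subset_closedBall w.2⟩ : Z) = L (1, w) := by
  let F : ℂ → Z := fun z => if ‖z‖ ≤ 1 / 2 then G (diskProj (2 * z))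
    else L (Set.projIcc 0 1 zero_le_one (2 * ‖z‖ - 1), dirSphere z)
  have hF : Continuous F := by
    refine continuous_if_le continuous_norm continuous_const
      (hG.comp (continuous_diskProj.comp (by fun_prop))).continuousOn ?_ ?_
    · refine hL.comp_continuousOn (ContinuousOn.prodMk
        (continuous_projIcc.comp (by fun_prop)).continuousOn ?_)
      intro z hz
      have h0 : z ≠ 0 := by
        rintro rfl
        have h1 : (1 / 2 : ℝ) ≤ ‖(0 : ℂ)‖ := hz
        norm_num at h1
      exact IsInducing.subtypeVal.continuousWithinAt_iff.2 (continuousAt_dir h0).continuousWithinAt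
    · intro z hz
      have h2 : ‖2 * z‖ = 1 := by rw [norm_mul, hz]; norm_num
      have h0 : z ≠ 0 := by rintro rfl; norm_num at hz
      have h3 : dir z = 2 * z := by
        rw [dir, if_neg h0, hz]; push_cast; ring
      have h4 : Set.projIcc (0 : ℝ) 1 zero_le_one (2 * ‖z‖ - 1) = 0 :=
        Set.projIcc_of_le_left _ (by rw [hz]; norm_num)
      rw [h4, hGL]
      congr 1
      refine Subtype.ext ?_
      simp only [dirSphere, diskProj, h3, unitClamp, h2]
      simp
  have hFS : ∀ z, F z ∈ S := fun z => by
    simp only [F]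
    split_ifs
    · exact hGS _
    · exact hLS _
  refine ⟨⟨fun z => ⟨F z, hFS z⟩, (hF.comp continuous_subtype_val).subtype_mk _⟩, fun w => ?_⟩
  have hw : ‖(w : ℂ)‖ = 1 := by simp
  have h1 : Set.projIcc (0 : ℝ) 1 zero_le_one (2 * ‖(w : ℂ)‖ - 1) = 1 :=
    Set.projIcc_of_right_le _ (by rw [hw]; norm_num)
  have h2 : dirSphere w = w := Subtype.ext (dir_of_norm_one hw)
  simp only [F, ContinuousMap.coe_mk, h1, h2]
  rw [if_neg (by rw [hw]; norm_num)]

/-- A loop in a round disk in the interior of the pants is coned off to the centre along straight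
segments. -/
theorem isOneUVZeroAt_ofPants {n : ℕ+} {z₀ : pairOfPants} (hz₀ : (z₀ : ℂ) ∈ pantsInterior) :
    IsOneUVZeroAt HawaiianPants (ofPants n z₀) := by
  intro U hU
  have h1 : ∀ᶠ w in 𝓝 (z₀ : ℂ), w ∈ pantsInterior ∧
      ∀ hw : w ∈ pairOfPants, ofPants n ⟨w, hw⟩ ∈ U := by
    refine (isOpen_pantsInterior.eventually_mem hz₀).and ?_
    have h2 : ∀ᶠ z in 𝓝 z₀, ofPants n z ∈ U := (continuous_ofPants n).continuousAt hU
    rw [nhds_subtype_eq_comap, eventually_comap] at h2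
    exact h2.mono fun w hw hw' => hw ⟨w, hw'⟩ rfl
  obtain ⟨ε, hε, hball⟩ := Metric.eventually_nhds_iff_ball.1 h1
  have hP : ∀ w ∈ Metric.ball (z₀ : ℂ) ε, w ∈ pairOfPants := fun w hw =>
    pantsInterior_subset (hball w hw).1
  refine ⟨openPants n ∩ planeCoord ⁻¹' Metric.ball (z₀ : ℂ) ε,
    (continuousOn_planeCoord n).isOpen_inter_preimage (isOpen_openPants n) Metric.isOpen_ball,
    ⟨ofPants_mem_openPants.2 ⟨rfl, hz₀⟩, ?_⟩, ?_, ?_⟩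
  · rw [Set.mem_preimage, planeCoord_ofPants hz₀]
    exact Metric.mem_ball_self hε
  · rintro p ⟨hp, hp'⟩
    obtain ⟨z, rfl, hz⟩ := mem_openPants_iff.1 hp
    rw [Set.mem_preimage, planeCoord_ofPants hz] at hp'
    exact (hball _ hp').2 z.2
  · intro f hf
    let b : Metric.sphere (0 : ℂ) 1 → HawaiianPants := fun w =>
      f ⟨w, Metric.sphere_subset_closedBall w.2⟩
    have hb : Continuous b := f.continuous.comp (continuous_subtype_val.subtype_mk _)
    have hbV : ∀ w, b w ∈ openPants n ∩ planeCoord ⁻¹' Metric.ball (z₀ : ℂ) ε := fun w =>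
      hf _ (by simp)
    have hc : Continuous fun w => planeCoord (b w) :=
      (continuousOn_planeCoord n).comp_continuous hb fun w => (hbV w).1
    have hmem : ∀ x : unitInterval × Metric.sphere (0 : ℂ) 1,
        (z₀ : ℂ) + ((x.1 : ℝ) : ℂ) * (planeCoord (b x.2) - z₀) ∈ Metric.ball (z₀ : ℂ) ε := by
      intro x
      have h := (convex_ball (z₀ : ℂ) ε).add_smul_sub_mem (Metric.mem_ball_self hε)
        (hbV x.2).2 x.1.2
      rwa [Complex.real_smul] at h
    obtain ⟨g, hg⟩ := exists_disk_of_annulus (S := U)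
      (G := fun _ => ofPants n z₀) continuous_const (fun _ => mem_of_mem_nhds hU)
      (L := fun x => ofPants n ⟨_, hP _ (hmem x)⟩)
      ((continuous_ofPants n).comp (Continuous.subtype_mk (continuous_const.add
        ((Complex.continuous_ofReal.comp (continuous_subtype_val.comp continuous_fst)).mul
          ((hc.comp continuous_snd).sub continuous_const))) _))
      (fun x => (hball _ (hmem x)).2 _) (fun w => by simp)
    refine ⟨g, fun z hz => ?_⟩
    have := hg ⟨z, by simpa using hz⟩
    rw [this]
    obtain ⟨y, hy, hy'⟩ := mem_openPants_iff.1 (hbV ⟨z, by simpa using hz⟩).1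
    have h3 : f z = b ⟨z, by simpa using hz⟩ := rfl
    rw [h3]
    refine Eq.trans ?_ hy.symm
    congr 1
    refine Subtype.ext ?_
    simp [hy, planeCoord_ofPants hy']

theorem isOneUVZeroAt_ofEarring (h₀ : hawaiianEarring) :
    IsOneUVZeroAt HawaiianPants (ofEarring h₀) := by
  intro U hU
  obtain ⟨r, hr, hrU, hrid⟩ := exists_earring_retraction h₀
    (continuous_ofEarring.continuousAt (interior_mem_nhds.2 hU))
  obtain ⟨W, hWr, hWo, hW₀⟩ := eventually_nhds_iff.1 hrid
  -- Points whose whole track stays in `U`; compactness of the interval makes this set open.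
  let T : Set HawaiianPants := {p | ∀ t, track p t ∈ interior U}
  have hT : IsOpen T := by
    have h := (ContinuousMap.isOpen_setOfPred_mapsTo (isCompact_univ (X := unitInterval))
      (isOpen_interior (s := U))).preimage continuous_track
    convert! h using 1
    ext p
    simp [T, Set.MapsTo]
  have hV : IsOpen (collar ∩ toEarring ⁻¹' W ∩ T) :=
    (continuousOn_toEarring.isOpen_inter_preimage isOpen_collar hWo).inter hT
  refine ⟨collar ∩ toEarring ⁻¹' W ∩ T, hV, ⟨⟨ofEarring_mem_collar h₀, hW₀⟩, ?_⟩, ?_, ?_⟩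
  · exact fun t => mem_interior_iff_mem_nhds.2 hU
  · rintro p ⟨_, hp⟩
    have := hp 0
    rw [track_zero] at this
    exact interior_subset this
  · intro f hf
    have htr : Continuous fun x : HawaiianPants × unitInterval => track x.1 x.2 :=
      ContinuousMap.continuous_uncurry_of_continuous ⟨track, continuous_track⟩
    -- The whole disk is pushed to time `1`, but only its boundary is known to land in the earring;
    -- `exists_disk_in_earring` replaces the interior.
    obtain ⟨g₀, hg₀⟩ := exists_disk_in_earring
      ⟨fun z => track (f z) 1, htr.comp (f.continuous.prodMk continuous_const)⟩
      fun z hz => ⟨_, (track_one (hf z hz).1.1).symm⟩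
    have hg₁ : ∀ z : Metric.closedBall (0 : ℂ) 1, ‖(z : ℂ)‖ = 1 → g₀ z = toEarring (f z) := by
      intro z hz
      have h : toEarring (ofEarring (g₀ z)) = toEarring (track (f z) 1) :=
        congrArg toEarring (hg₀ z hz)
      rwa [toEarring_ofEarring, track_one (hf z hz).1.1, toEarring_ofEarring] at h
    let b : Metric.sphere (0 : ℂ) 1 → HawaiianPants := fun w =>
      f ⟨w, Metric.sphere_subset_closedBall w.2⟩
    have hb : Continuous b := f.continuous.comp (continuous_subtype_val.subtype_mk _)
    obtain ⟨g, hg⟩ := exists_disk_of_annulus (S := U)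
      (G := fun z => ofEarring (r (g₀ z))) (continuous_ofEarring.comp (hr.comp g₀.continuous))
      (fun z => interior_subset (hrU (g₀ z)))
      -- The track is run backwards, from the pushed loop, which `r` fixes because it lies in `W`,
      -- out to the original loop.
      (L := fun x => track (b x.2) (unitInterval.symm x.1))
      (htr.comp ((hb.comp continuous_snd).prodMk
        (unitInterval.continuous_symm.comp continuous_fst)))
      (fun x => interior_subset ((hf _ (by simp)).2 _))
      (fun w => by
        have hw := hf ⟨w, Metric.sphere_subset_closedBall w.2⟩ (by simp)
        rw [unitInterval.symm_zero, hg₁ _ (by simp), hWr _ hw.1.2]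
        exact track_one hw.1.1)
    refine ⟨g, fun z hz => ?_⟩
    have := hg ⟨z, by simpa using hz⟩
    rw [this, unitInterval.symm_one, track_zero]

theorem mainTheorem5 : IsOneUVZero HawaiianPants := by
  intro x
  rcases exists_eq_ofEarring_or x with ⟨h, rfl⟩ | ⟨n, z, rfl, hz⟩
  · exact isOneUVZeroAt_ofEarring h
  · exact isOneUVZeroAt_ofPants hz
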